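/- Let $M$ be a smooth, Hausdorff, paracompact, finite-dimensional manifold and let $(E,[\![\cdot,\cdot]\!],\rho)$ be a Lie algebroid over $M$: $E\to M$ is a smooth real vector bundle of finite rank, $[\![\cdot,\cdot]\!]$ is a Lie bracket on the space $\Gamma(E)$ of smooth sections, and $\rho:E\to TM$ is a bundle map with $[\![X,fY]\!]=f[\![X,Y]\!]+\rho(X)(f)\,Y$. Write $d^E$ for its differential, so that $(d^Ef)(X)=\rho(X)(f)$ for a function $f$ on $M$ and $(d^E\alpha)(X,Y)=\rho(X)(\alpha(Y))-\rho(Y)(\alpha(X))-\alpha([\![X,Y]\!])$ for $\alpha\in\Gamma(E^*)$. Let $\tau^*:E^*\to M$ be the dual bundle and let $\mathcal L^{\tau^*}E=\{(b,v)\in E\times TE^* : \rho(b)=(T\tau^*)(v)\}$ be the prolongation of $E$ over $\tau^*$. It is a Lie algebroid over $E^*$, with anchor $\rho^{\tau^*}(b,v)=v$ and the bracket for which $$[\![(f_i(X_i\circ\tau^*),X'),(g_j(Y_j\circ\tau^*),Y')]\!]^{\tau^*}=\bigl(f_ig_j([\![X_i,Y_j]\!]\circ\tau^*)+X'(g_j)(Y_j\circ\tau^*)-Y'(f_i)(X_i\circ\tau^*),\,[X',Y']\bigr)$$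 (with summation over repeated indices), where $X_i,Y_j\in\Gamma(E)$, $f_i,g_j\in C^\infty(E^*)$ and $X',Y'$ are vector fields on $E^*$. Let $\lambda_E(a)(b,v)=a(b)$ be its Liouville section and $\Omega_E=-d^{\mathcal L^{\tau^*}E}\lambda_E$ its canonical symplectic section. Let $H:E^*\to\mathbb R$ be smooth. There is a unique smooth section $\xi_H$ of $\mathcal L^{\tau^*}E$ with $i_{\xi_H}\Omega_E=d^{\mathcal L^{\tau^*}E}H$ (the Hamiltonian section of $H$). A curve in $E^*$, defined on an open interval, is said to satisfy the Hamilton equations for $H$ if it is an integral curve of the vector field $\rho^{\tau^*}(\xi_H)$. Let $\alpha\in\Gamma(E^*)$ be a 1-cocycle, $d^E\alpha=0$, and let $\sigma=\mathrm{pr}_1\circ\xi_H\circ\alpha\in\Gamma(E)$, where $\mathrm{pr}_1:\mathcal L^{\tau^*}E\to E$ is the first projection. Then the following two conditions are equivalent: (a) for every curve $c$ in $M$, defined on an open interval, with $\rho(\sigma)(c(t))=\dot c(t)$ for all $t$, the curve $t\mapsto\alpha(c(t))$ satisfies the Hamilton equations for $H$; (b) $\alpha$ satisfies the Hamilton–Jacobi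 equation $d^E(H\circ\alpha)=0$. Moreover, (b) holds if and only if $H\circ\alpha$ is constant on the leaves of the Lie algebroid foliation, i.e. of the generalized foliation of the distribution $x\mapsto\rho(E_x)$, whose leaves are the orbits of the family of vector fields $\rho(X)$, $X\in\Gamma(E)$. -/

import Mathlib

open Set Filter Topology Bundle
open scoped Manifold ContDiff

noncomputable section

section Basics

variable {EM : Type*} [NormedAddCommGroup EM] [NormedSpace ℝ EM]
  {M : Type*} [TopologicalSpace M] [ChartedSpace EM M]
  (F : Type*) [NormedAddCommGroup F] [NormedSpace ℝ F]
  (E : M → Type*) [∀ x, AddCommGroup (E x)] [∀ x, Module ℝ (E x)]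
  [∀ x, TopologicalSpace (E x)] [TopologicalSpace (TotalSpace F E)]
  [FiberBundle F E] [VectorBundle ℝ F E]

/-- The total space of the dual bundle `E*`; its point over `x` are the linear forms on `E x`. -/
abbrev DualBundle : Type _ := TotalSpace (F →L[ℝ] ℝ) (fun x : M => E x →L[ℝ] ℝ)

/-- The smooth sections of the vector bundle `E`. -/
abbrev SmoothSections : Type _ := Cₛ^∞⟮𝓘(ℝ, EM); F, E⟯

/-- The smooth sections of the dual bundle `E*`. -/
abbrev DualSections : Type _ := Cₛ^∞⟮𝓘(ℝ, EM); F →L[ℝ] ℝ, fun x : M => E x →L[ℝ] ℝ⟯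

variable {F E} in
/-- The product of a smooth function and a smooth section. -/
def smulSection (f : M → ℝ) (hf : ContMDiff 𝓘(ℝ, EM) 𝓘(ℝ, ℝ) ∞ f)
    (X : SmoothSections (EM := EM) F E) : SmoothSections (EM := EM) F E :=
  ⟨f • ⇑X, hf.smul_section X.contMDiff⟩

variable {F E} in
/-- A section of `E*`, seen as a map from the base to the total space of `E*`. -/
def sectionMap (α : DualSections (EM := EM) F E) (x : M) : DualBundle F E := ⟨x, α x⟩

/-- A Lie algebroid structure on the smooth real vector bundle `E → M`: a Lie bracket on the
space of smooth sections and a bundle map `E → TM` over the identity (the anchor, here a smooth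
section of `Hom(E, TM)`), related by the Leibniz rule. -/
structure LieAlgebroid [IsManifold 𝓘(ℝ, EM) ∞ M] [ContMDiffVectorBundle ∞ F E 𝓘(ℝ, EM)] where
  /-- the anchor map -/
  anchor : Cₛ^∞⟮𝓘(ℝ, EM); F →L[ℝ] EM, fun x : M => E x →L[ℝ] TangentSpace 𝓘(ℝ, EM) x⟯
  /-- the bracket of sections -/
  bracket : SmoothSections (EM := EM) F E →ₗ[ℝ]
    SmoothSections (EM := EM) F E →ₗ[ℝ] SmoothSections (EM := EM) F E
  bracket_self : ∀ X, bracket X X = 0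
  jacobi : ∀ X Y Z,
    bracket X (bracket Y Z) = bracket (bracket X Y) Z + bracket Y (bracket X Z)
  leibniz : ∀ (X Y : SmoothSections (EM := EM) F E) (f : M → ℝ)
    (hf : ContMDiff 𝓘(ℝ, EM) 𝓘(ℝ, ℝ) ∞ f) (x : M),
    bracket X (smulSection f hf Y) x =
      f x • bracket X Y x + mvfderiv 𝓘(ℝ, EM) f x (anchor x (X x)) • Y x

end Basics

section Frames

variable {EM : Type*} [NormedAddCommGroup EM] [NormedSpace ℝ EM] [FiniteDimensional ℝ EM]
  {M : Type*} [TopologicalSpace M] [ChartedSpace EM M] [IsManifold 𝓘(ℝ, EM) ∞ M] [T2Space M]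
  {F : Type*} [NormedAddCommGroup F] [NormedSpace ℝ F]
  {E : M → Type*} [∀ x, AddCommGroup (E x)] [∀ x, Module ℝ (E x)]
  [∀ x, TopologicalSpace (E x)] [TopologicalSpace (TotalSpace F E)]
  [FiberBundle F E] [VectorBundle ℝ F E] [ContMDiffVectorBundle ∞ F E 𝓘(ℝ, EM)]

variable (F E) in
theorem exists_frameBump (x₀ : M) : ∃ f : SmoothBumpFunction 𝓘(ℝ, EM) x₀,
    tsupport f ⊆ (trivializationAt F E x₀).baseSet := by
  obtain ⟨f, -, hf⟩ := (SmoothBumpFunction.nhds_basis_tsupport (I := 𝓘(ℝ, EM)) x₀).mem_iff.1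
    ((trivializationAt F E x₀).open_baseSet.mem_nhds
      (FiberBundle.mem_baseSet_trivializationAt' x₀))
  exact ⟨f, hf⟩

variable (F E) in
/-- A smooth bump function at `x₀`, equal to `1` near `x₀` and supported in the domain of the
preferred trivialization of `E` at `x₀`. -/
def frameBump (x₀ : M) : SmoothBumpFunction 𝓘(ℝ, EM) x₀ :=
  (exists_frameBump (EM := EM) F E x₀).choose

variable (EM E) in
/-- The global smooth section of `E` that is, near `x₀`, the section with constant coordinates
`u` in the preferred trivialization at `x₀`. As `u` runs through a basis of `F`, these sections
form a frame of `E` near `x₀`. -/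
def frameSection (x₀ : M) (u : F) : SmoothSections (EM := EM) F E :=
  ⟨(frameBump (EM := EM) F E x₀ : M → ℝ) • fun x => (trivializationAt F E x₀).symm x u, by
    refine ContMDiffOn.smul_section_of_tsupport (u := (trivializationAt F E x₀).baseSet)
      (frameBump (EM := EM) F E x₀).contMDiff.contMDiffOn (trivializationAt F E x₀).open_baseSet
      (exists_frameBump (EM := EM) F E x₀).choose_spec ?_
    rw [(trivializationAt F E x₀).contMDiffOn_section_baseSet_iff]
    refine (contMDiffOn_const (c := u)).congr fun x hx => ?_
    simp [(trivializationAt F E x₀).apply_mk_symm hx]⟩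

end Frames

namespace LieAlgebroid

variable {EM : Type*} [NormedAddCommGroup EM] [NormedSpace ℝ EM]
  {M : Type*} [TopologicalSpace M] [ChartedSpace EM M] [IsManifold 𝓘(ℝ, EM) ∞ M]
  {F : Type*} [NormedAddCommGroup F] [NormedSpace ℝ F]
  {E : M → Type*} [∀ x, AddCommGroup (E x)] [∀ x, Module ℝ (E x)]
  [∀ x, TopologicalSpace (E x)] [TopologicalSpace (TotalSpace F E)]
  [FiberBundle F E] [VectorBundle ℝ F E] [ContMDiffVectorBundle ∞ F E 𝓘(ℝ, EM)]
  (A : LieAlgebroid (EM := EM) F E)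

/-- The vector field `ρ(s)` on `M`, for a section `s` of `E`. -/
def anchorField (s : ∀ x, E x) (x : M) : TangentSpace 𝓘(ℝ, EM) x := A.anchor x (s x)

/-- The differential `d^E f` of a function: the section of `E*` with `(d^E f)(X) = ρ(X)(f)`. -/
def dFun (f : M → ℝ) (x : M) : E x →L[ℝ] ℝ := (mvfderiv 𝓘(ℝ, EM) f x).comp (A.anchor x)

/-- The differential `d^E α` of a section `α` of `E*`, as a function of two sections of `E`:
`(d^E α)(X, Y) = ρ(X)(α(Y)) - ρ(Y)(α(X)) - α([X, Y])`. -/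
def dForm (α : DualSections (EM := EM) F E) (X Y : SmoothSections (EM := EM) F E) (x : M) : ℝ :=
  mvfderiv 𝓘(ℝ, EM) (fun y => α y (Y y)) x (A.anchor x (X x))
    - mvfderiv 𝓘(ℝ, EM) (fun y => α y (X y)) x (A.anchor x (Y x))
    - α x (A.bracket X Y x)

/-- `α` is a 1-cocycle of the Lie algebroid: `d^E α = 0`. -/
def IsCocycle (α : DualSections (EM := EM) F E) : Prop := ∀ X Y x, A.dForm α X Y x = 0

/-- The points of `M` that one reaches from `x` by following an integral curve of the vector
field `ρ(X)` of some section `X` of `E`, forward or backward, for some time. -/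
def FlowStep (x y : M) : Prop :=
  ∃ (X : SmoothSections (EM := EM) F E) (c : ℝ → M) (J : Set ℝ),
    IsOpen J ∧ J.OrdConnected ∧ IsMIntegralCurveOn c (A.anchorField X) J ∧
      ∃ s ∈ J, ∃ t ∈ J, c s = x ∧ c t = y

/-- The leaf through `x` of the Lie algebroid foliation, i.e. of the generalized foliation
(in the sense of Sussmann) of the distribution `x ↦ ρ(E x)`: the orbit of `x` under
the flows of the vector fields `ρ(X)`, `X` a section of `E`. -/
def leaf (x : M) : Set M := {y | Relation.ReflTransGen A.FlowStep x y}

/-- The differential `T τ*` of the projection `τ* : E* → M` at a point of `E*`. -/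
def projDeriv (a : DualBundle F E) :
    TangentSpace (𝓘(ℝ, EM).prod 𝓘(ℝ, F →L[ℝ] ℝ)) a →L[ℝ] TangentSpace 𝓘(ℝ, EM) a.proj :=
  mfderiv (𝓘(ℝ, EM).prod 𝓘(ℝ, F →L[ℝ] ℝ)) 𝓘(ℝ, EM) (fun a' : DualBundle F E => a'.proj) a

/-- The fibre over `a ∈ E*` of the prolongation of `E` over the projection `τ* : E* → M`:
the pairs `(b, v)`, `b` in the fibre of `E` over `τ*(a)` and `v ∈ T_a E*`, with
`ρ(b) = (T τ*)(v)`. -/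
def prolongation (a : DualBundle F E) :
    Submodule ℝ (E a.proj × TangentSpace (𝓘(ℝ, EM).prod 𝓘(ℝ, F →L[ℝ] ℝ)) a) where
  carrier := {w | A.anchor a.proj w.1 = projDeriv a w.2}
  add_mem' {w w'} hw hw' := by
    change A.anchor a.proj (w.1 + w'.1) = projDeriv a (w.2 + w'.2)
    rw [ContinuousLinearMap.map_add, ContinuousLinearMap.map_add]
    exact congrArg₂ (· + ·) hw hw'
  zero_mem' := by
    change A.anchor a.proj 0 = projDeriv a 0
    rw [ContinuousLinearMap.map_zero, ContinuousLinearMap.map_zero]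
  smul_mem' r {w} hw := by
    change A.anchor a.proj (r • w.1) = projDeriv a (r • w.2)
    rw [ContinuousLinearMap.map_smul, ContinuousLinearMap.map_smul]
    exact congrArg (r • ·) hw

/-- The smooth sections of the prolongation: the pairs of a smooth section of the pullback
bundle `(τ*)^* E` and a smooth vector field on `E*` with values in the fibres of the
prolongation. -/
@[ext]
structure ProlongationSection where
  /-- the value at a point of `E*` -/
  val : ∀ a : DualBundle F E, A.prolongation a
  smooth_fst : ContMDiff (𝓘(ℝ, EM).prod 𝓘(ℝ, F →L[ℝ] ℝ)) (𝓘(ℝ, EM).prod 𝓘(ℝ, F)) ∞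
    (fun a : DualBundle F E => (⟨a.proj, (val a).1.1⟩ : TotalSpace F E))
  smooth_snd : ContMDiff (𝓘(ℝ, EM).prod 𝓘(ℝ, F →L[ℝ] ℝ))
    (𝓘(ℝ, EM).prod 𝓘(ℝ, F →L[ℝ] ℝ)).tangent ∞
    (fun a : DualBundle F E =>
      (⟨a, (val a).1.2⟩ : TangentBundle (𝓘(ℝ, EM).prod 𝓘(ℝ, F →L[ℝ] ℝ)) (DualBundle F E)))

namespace ProlongationSection

variable {A}

/-- The first component of a section of the prolongation, a section of `E` along `τ*`. -/
def fst (Z : A.ProlongationSection) (a : DualBundle F E) : E a.proj := (Z.val a).1.1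

/-- The second component of a section of the prolongation, a vector field on `E*`. It is the
image of the section under the anchor `ρ^{τ*}` of the prolongation. -/
def anchorField (Z : A.ProlongationSection) (a : DualBundle F E) :
    TangentSpace (𝓘(ℝ, EM).prod 𝓘(ℝ, F →L[ℝ] ℝ)) a := (Z.val a).1.2

/-- The coordinates of the first component in the preferred trivialization of `E` at `x₀`. -/
def coord (Z : A.ProlongationSection) (x₀ : M) (a : DualBundle F E) : F :=
  (trivializationAt F E x₀ ⟨a.proj, Z.fst a⟩).2

/-- The derivative of the coordinates of `Z` in the direction of the vector field of `Y`, as an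
element of the fibre of `E`. If `Z = (g_j e_j ∘ τ*, Z')` and `Y = (_, Y')`, where `(e_j)` is the
frame of constant coordinates in the preferred trivialization at `τ*(a)`, then this is
`Y'(g_j)(a) e_j(τ*(a))`. -/
def coordDeriv (Y Z : A.ProlongationSection) (a : DualBundle F E) : E a.proj :=
  (trivializationAt F E a.proj).symm a.proj
    (mvfderiv (𝓘(ℝ, EM).prod 𝓘(ℝ, F →L[ℝ] ℝ)) (Z.coord a.proj) a (Y.anchorField a))

variable [FiniteDimensional ℝ EM] [T2Space M]

/-- The bracket of the prolongation. For sections `Y = (f_i (e_i ∘ τ*), Y')` and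
`Z = (g_j (e_j ∘ τ*), Z')`, with `(e_i)` a frame of `E` near `τ*(a)`, its value at `a` is
`(f_i g_j [e_i, e_j] + Y'(g_j) e_j - Z'(f_i) e_i, [Y', Z'])`. The frame used here
is the one of constant coordinates in the preferred trivialization at `τ*(a)`; by the Leibniz
rule the value does not depend on this choice. -/
def bracket (Y Z : A.ProlongationSection) (a : DualBundle F E) :
    E a.proj × TangentSpace (𝓘(ℝ, EM).prod 𝓘(ℝ, F →L[ℝ] ℝ)) a :=
  (A.bracket (frameSection EM E a.proj (Y.coord a.proj a))
      (frameSection EM E a.proj (Z.coord a.proj a)) a.proj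
      + coordDeriv Y Z a - coordDeriv Z Y a,
    VectorField.mlieBracket (𝓘(ℝ, EM).prod 𝓘(ℝ, F →L[ℝ] ℝ)) Y.anchorField Z.anchorField a)

end ProlongationSection

/-- The Liouville section `λ_E` of the dual of the prolongation: `λ_E(a)(b, v) = a(b)`. -/
def liouville (a : DualBundle F E)
    (w : E a.proj × TangentSpace (𝓘(ℝ, EM).prod 𝓘(ℝ, F →L[ℝ] ℝ)) a) : ℝ := a.2 w.1

variable [FiniteDimensional ℝ EM] [T2Space M]

variable {A} in
/-- The differential, for the prolongation, of a section `θ` of its dual, as a function of two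
sections: `(dθ)(Y, Z) = ρ^{τ*}(Y)(θ(Z)) - ρ^{τ*}(Z)(θ(Y)) - θ([Y, Z]^{τ*})`. -/
def dProlongation
    (θ : ∀ a : DualBundle F E,
      E a.proj × TangentSpace (𝓘(ℝ, EM).prod 𝓘(ℝ, F →L[ℝ] ℝ)) a → ℝ)
    (Y Z : A.ProlongationSection) (a : DualBundle F E) : ℝ :=
  mvfderiv (𝓘(ℝ, EM).prod 𝓘(ℝ, F →L[ℝ] ℝ)) (fun a' => θ a' (Z.val a')) a (Y.anchorField a)
    - mvfderiv (𝓘(ℝ, EM).prod 𝓘(ℝ, F →L[ℝ] ℝ)) (fun a' => θ a' (Y.val a')) a (Z.anchorField a)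
    - θ a (Y.bracket Z a)

variable {A} in
/-- The canonical symplectic section `Ω_E = -d λ_E` of the prolongation. -/
def symplecticSection (Y Z : A.ProlongationSection) (a : DualBundle F E) : ℝ :=
  -dProlongation liouville Y Z a

variable {A} in
/-- `ξ` is the Hamiltonian section of `H`: `i_ξ Ω_E = d H`, where `d H` is the differential of
`H` for the prolongation, `(d H)(Z) = ρ^{τ*}(Z)(H)`. -/
def IsHamiltonianSection (H : DualBundle F E → ℝ) (ξ : A.ProlongationSection) : Prop :=
  ∀ (Z : A.ProlongationSection) (a : DualBundle F E),
    symplecticSection ξ Z a =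
      mvfderiv (𝓘(ℝ, EM).prod 𝓘(ℝ, F →L[ℝ] ℝ)) H a (Z.anchorField a)

variable {A} in
/-- On the open interval `J`, the curve `μ` in `E*` solves the Hamilton equations of
the Hamiltonian function whose Hamiltonian section is `ξ`: it is an integral curve of the
vector field `ρ^{τ*}(ξ)`. -/
def SolvesHamiltonEquations (ξ : A.ProlongationSection) (μ : ℝ → DualBundle F E)
    (J : Set ℝ) : Prop :=
  IsMIntegralCurveOn μ ξ.anchorField J

end LieAlgebroid

end

/-!
# The Hamilton–Jacobi theorem for Lie algebroids

Near a point `x₀` of `M`, the preferred trivialization of `E` gives linear coordinates on the fibres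
of `E` and dual coordinates `p` on the fibres of `E*`. A point `(b, v)` of the prolongation is then
the pair `(z, φ)` of the coordinates `z` of `b` and of `φ = dp(v)`, since `T τ*(v) = ρ(b)` is
already fixed by `b` (`tangent_ext`). In these coordinates the canonical symplectic section is
`Ω((y, φ), (z, ψ)) = ψ(y) - φ(z) + a([e_y, e_z])` (`symplecticSection_eq`), where `e_y`, `e_z` are
the sections of `E` with constant coordinates. The bracket of the prolongation is defined with the
trivialization centred at the base point, so this requires comparing two trivializations
(`ProlongationSection.bracket_fst_eq`); the terms with derivatives of the transition functions
cancel by the Leibniz rule, in the form of the local expression of the bracket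
(`bracket_apply_eq_frame`).

The formula makes `Ω` nondegenerate, and `i_ξ Ω = dH` is solved, smoothly over a neighbourhood of
`x₀`, by `y = ∂H/∂p` and `φ(z) = a([e_y, e_z]) - dH(z, 0)`; the local solutions agree by
nondegeneracy (`existsUnique_hamiltonianSection`).

For a cocycle `α` one evaluates `i_ξ Ω = dH` at `α(x)` on the vectors `(e_z, Tα(ρ(e_z)))`.
Substituting `d^E α(σ, e_z) = 0` gives
`d^E(H ∘ α)(e_z) = ⟨dp(Tα(ρ(σ(x))) - X_H(α(x))), z⟩` (`dFun_comp_sectionMap_apply`), with `X_H` the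
vector field `ρ^{τ*}(ξ)`. Hence the Hamilton–Jacobi equation at `x` says exactly that `Tα` maps
`ρ(σ(x))` to `X_H(α(x))`. Composing with integral curves of `ρ(σ)`, which exist through every point,
yields the first equivalence. The statement on leaves holds because `d^E f` evaluated on a section
`X` is the derivative of `f` along the integral curves of `ρ(X)`, and every vector of `E` is the
value of a section.
-/

set_option linter.unusedSectionVars false

noncomputable section

/-! ### Derivatives of vector-valued functions on manifolds -/

section VectorValued

variable {EN : Type*} [NormedAddCommGroup EN] [NormedSpace ℝ EN]
  {HN : Type*} [TopologicalSpace HN] {I : ModelWithCorners ℝ EN HN}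
  {N : Type*} [TopologicalSpace N] [ChartedSpace HN N]
  {V W : Type*} [NormedAddCommGroup V] [NormedSpace ℝ V] [NormedAddCommGroup W] [NormedSpace ℝ W]

theorem mvfderiv_congr {f g : N → V} {x : N} (h : f =ᶠ[𝓝 x] g) :
    mvfderiv I f x = mvfderiv I g x := by
  ext v
  exact DFunLike.congr_fun (h.mfderiv_eq (I := I) (I' := 𝓘(ℝ, V))) v

theorem mvfderiv_clm_apply {g : N → V →L[ℝ] W} {f : N → V} {x : N}
    (hg : MDifferentiableAt I 𝓘(ℝ, V →L[ℝ] W) g x) (hf : MDifferentiableAt I 𝓘(ℝ, V) f x)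
    (v : TangentSpace I x) :
    mvfderiv I (fun y => g y (f y)) x v
      = g x (mvfderiv I f x v) + mvfderiv I g x v (f x) := by
  let f' : EN →L[ℝ] V := mvfderiv I f x
  let g' : EN →L[ℝ] V →L[ℝ] W := mvfderiv I g x
  have key : HasMFDerivAt I 𝓘(ℝ, W) (fun y => g y (f y)) x ((g x).comp f' + g'.flip (f x)) := by
    refine ⟨hg.continuousAt.clm_apply hf.continuousAt, ?_⟩
    convert! hg.hasMFDerivAt.2.clm_apply hf.hasMFDerivAt.2 using 1
    simp
    rfl
  exact DFunLike.congr_fun key.mfderiv v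

theorem mvfderiv_clm_comp (L : V →L[ℝ] W) {f : N → V} {x : N}
    (hf : MDifferentiableAt I 𝓘(ℝ, V) f x) (v : TangentSpace I x) :
    mvfderiv I (fun y => L (f y)) x v = L (mvfderiv I f x v) := by
  rw [mvfderiv_clm_apply (g := fun _ => L) mdifferentiableAt_const hf, mvfderiv_const]
  simp

theorem mvfderiv_apply_const {g : N → V →L[ℝ] W} {x : N}
    (hg : MDifferentiableAt I 𝓘(ℝ, V →L[ℝ] W) g x) (u : V) (v : TangentSpace I x) :
    mvfderiv I (fun y => g y u) x v = mvfderiv I g x v u := by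
  rw [mvfderiv_clm_apply (f := fun _ => u) hg mdifferentiableAt_const, mvfderiv_const]
  simp

theorem comp_smulRight_one (L : V →L[ℝ] W) (v : V) :
    L.comp ((1 : ℝ →L[ℝ] ℝ).smulRight v) = (1 : ℝ →L[ℝ] ℝ).smulRight (L v) := by
  ext
  simp

theorem smulRight_one_injective :
    Function.Injective fun v : V => (1 : ℝ →L[ℝ] ℝ).smulRight v := fun v w h => by
  simpa using DFunLike.congr_fun h (1 : ℝ)

theorem mvfderiv_comp_vector {EN' : Type*} [NormedAddCommGroup EN'] [NormedSpace ℝ EN']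
    {HN' : Type*} [TopologicalSpace HN'] {I' : ModelWithCorners ℝ EN' HN'}
    {N' : Type*} [TopologicalSpace N'] [ChartedSpace HN' N'] {g : N' → V} {f : N → N'} {x : N}
    (hg : MDifferentiableAt I' 𝓘(ℝ, V) g (f x)) (hf : MDifferentiableAt I I' f x)
    (v : TangentSpace I x) :
    mvfderiv I (fun y => g (f y)) x v = mvfderiv I' g (f x) (mfderiv I I' f x v) :=
  mfderiv_comp_apply x hg hf v

end VectorValued

namespace LieAlgebroid

variable {EM : Type*} [NormedAddCommGroup EM] [NormedSpace ℝ EM] [FiniteDimensional ℝ EM]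
  {M : Type*} [TopologicalSpace M] [ChartedSpace EM M] [IsManifold 𝓘(ℝ, EM) ∞ M] [T2Space M]
  {F : Type*} [NormedAddCommGroup F] [NormedSpace ℝ F]
  {E : M → Type*} [∀ x, AddCommGroup (E x)] [∀ x, Module ℝ (E x)]
  [∀ x, TopologicalSpace (E x)] [TopologicalSpace (TotalSpace F E)]
  [FiberBundle F E] [VectorBundle ℝ F E] [ContMDiffVectorBundle ∞ F E 𝓘(ℝ, EM)]

/-! ### Frames and the local expression of the bracket -/

variable (EM F E) in
/-- The open neighbourhood of `x₀` on which the bump function defining `frameSection` is locally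
constant equal to `1`, so that the sections `frameSection EM E x₀ u` have constant coordinates. -/
def frameDomain (x₀ : M) : Set M := {x | ∀ᶠ y in 𝓝 x, frameBump (EM := EM) F E x₀ y = 1}

theorem isOpen_frameDomain (x₀ : M) : IsOpen (frameDomain EM F E x₀) :=
  isOpen_setOfPred_eventually_nhds

theorem mem_frameDomain_self (x₀ : M) : x₀ ∈ frameDomain EM F E x₀ :=
  (frameBump (EM := EM) F E x₀).eventuallyEq_one

theorem frameBump_eq_one {x₀ x : M} (hx : x ∈ frameDomain EM F E x₀) :
    frameBump (EM := EM) F E x₀ x = 1 := hx.self_of_nhds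

theorem tsupport_frameBump_subset (x₀ : M) :
    tsupport (frameBump (EM := EM) F E x₀) ⊆ (trivializationAt F E x₀).baseSet :=
  (exists_frameBump (EM := EM) F E x₀).choose_spec

theorem frameDomain_subset_tsupport (x₀ : M) :
    frameDomain EM F E x₀ ⊆ tsupport (frameBump (EM := EM) F E x₀) := fun x hx =>
  subset_tsupport _ (by simp [frameBump_eq_one hx])

theorem frameDomain_subset_baseSet (x₀ : M) :
    frameDomain EM F E x₀ ⊆ (trivializationAt F E x₀).baseSet :=
  (frameDomain_subset_tsupport x₀).trans (tsupport_frameBump_subset x₀)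

theorem frameSection_apply (x₀ : M) (u : F) (x : M) :
    frameSection EM E x₀ u x =
      frameBump (EM := EM) F E x₀ x • (trivializationAt F E x₀).symmL ℝ x u := by
  change frameBump (EM := EM) F E x₀ x • (trivializationAt F E x₀).symm x u = _
  by_cases hx : x ∈ (trivializationAt F E x₀).baseSet
  · rw [(trivializationAt F E x₀).symmL_apply hx]
  · rw [image_eq_zero_of_notMem_tsupport fun h => hx (tsupport_frameBump_subset x₀ h)]
    simp

theorem frameSection_apply_of_mem {x₀ x : M} (hx : x ∈ frameDomain EM F E x₀) (u : F) :
    frameSection EM E x₀ u x = (trivializationAt F E x₀).symmL ℝ x u := by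
  rw [frameSection_apply, frameBump_eq_one hx, one_smul]

theorem frameSection_add (x₀ : M) (u v : F) :
    frameSection EM E x₀ (u + v) = frameSection EM E x₀ u + frameSection EM E x₀ v := by
  ext x
  simp [frameSection_apply]

theorem frameSection_smul (x₀ : M) (r : ℝ) (u : F) :
    frameSection EM E x₀ (r • u) = r • frameSection EM E x₀ u := by
  ext x
  simp [frameSection_apply, smul_comm r]

theorem sum_apply {ι : Type*} (s : Finset ι) (X : ι → SmoothSections (EM := EM) F E) (x : M) :
    (∑ i ∈ s, X i) x = ∑ i ∈ s, X i x := by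
  have h := congrFun (map_sum (ContMDiffSection.coeAddHom 𝓘(ℝ, EM) F ∞ E) X s) x
  simpa only [ContMDiffSection.coeAddHom_apply, Finset.sum_apply] using h

variable (EM E) in
/-- `frameSection` as a linear map in the coordinates. -/
def frameSectionₗ (x₀ : M) : F →ₗ[ℝ] SmoothSections (EM := EM) F E where
  toFun := frameSection EM E x₀
  map_add' := frameSection_add x₀
  map_smul' := frameSection_smul x₀

/-- The coordinates of a section in the preferred trivialization at `x₀`. -/
def sectionCoord (x₀ : M) (X : ∀ x, E x) (x : M) : F :=
  (trivializationAt F E x₀).continuousLinearMapAt ℝ x (X x)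

theorem contMDiffOn_sectionCoord (x₀ : M) (X : SmoothSections (EM := EM) F E) :
    ContMDiffOn 𝓘(ℝ, EM) 𝓘(ℝ, F) ∞ (sectionCoord (F := F) x₀ X)
      (trivializationAt F E x₀).baseSet := by
  have h := (trivializationAt F E x₀).contMDiffOn_section_baseSet_iff.1
    (X.contMDiff.contMDiffOn (s := (trivializationAt F E x₀).baseSet))
  refine h.congr fun x hx => ?_
  simp [sectionCoord, Trivialization.continuousLinearMapAt_apply_of_mem, hx]

theorem mdifferentiableAt_sectionCoord {x₀ x : M} (X : SmoothSections (EM := EM) F E)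
    (hx : x ∈ (trivializationAt F E x₀).baseSet) :
    MDifferentiableAt 𝓘(ℝ, EM) 𝓘(ℝ, F) (sectionCoord (F := F) x₀ X) x :=
  ((contMDiffOn_sectionCoord x₀ X).contMDiffAt
    ((trivializationAt F E x₀).open_baseSet.mem_nhds hx)).mdifferentiableAt (by simp)

theorem sectionCoord_frameSection {x₀ x : M} (hx : x ∈ frameDomain EM F E x₀) (u : F) :
    sectionCoord x₀ (frameSection EM E x₀ u) x = u := by
  rw [sectionCoord, frameSection_apply_of_mem hx,
    Trivialization.continuousLinearMapAt_symmL _ (frameDomain_subset_baseSet x₀ hx)]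

theorem frameSection_sectionCoord {x₀ x : M} (hx : x ∈ frameDomain EM F E x₀) (X : ∀ x, E x) :
    frameSection EM E x₀ (sectionCoord (F := F) x₀ X x) x = X x := by
  rw [frameSection_apply_of_mem hx]
  exact Trivialization.symmL_continuousLinearMapAt _ (frameDomain_subset_baseSet x₀ hx) (X x)

variable (A : LieAlgebroid (EM := EM) F E)

theorem bracket_swap (X Y : SmoothSections (EM := EM) F E) :
    A.bracket X Y = -A.bracket Y X := by
  have h := A.bracket_self (X + Y)
  simp only [map_add, LinearMap.add_apply, A.bracket_self, zero_add, add_zero] at h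
  exact eq_neg_of_add_eq_zero_right h

/-- The bracket of sections is a local operator: multiplying `Y` by a bump function supported where
`Y` vanishes gives `0`, and the Leibniz rule reads off the value of the bracket at the centre. -/
theorem bracket_apply_eq_zero_of_eventually {X Y : SmoothSections (EM := EM) F E} {x : M}
    (hY : ∀ᶠ y in 𝓝 x, Y y = 0) : A.bracket X Y x = 0 := by
  obtain ⟨f, -, hf⟩ := (SmoothBumpFunction.nhds_basis_support (I := 𝓘(ℝ, EM)) hY).mem_iff.1 hY
  have h0 : smulSection f f.contMDiff Y = 0 := by
    ext y
    change f y • Y y = 0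
    by_cases hy : f y = 0
    · rw [hy, zero_smul]
    · rw [show Y y = 0 from hf hy, smul_zero]
  have h := A.leibniz X Y f f.contMDiff x
  rw [h0, hY.self_of_nhds, f.eq_one] at h
  simpa using h.symm

theorem bracket_congr_right {X Y Y' : SmoothSections (EM := EM) F E} {x : M}
    (h : ∀ᶠ y in 𝓝 x, Y y = Y' y) : A.bracket X Y x = A.bracket X Y' x := by
  have := A.bracket_apply_eq_zero_of_eventually (X := X) (Y := Y - Y') (x := x)
    (h.mono fun y hy => by simp [hy])
  rw [map_sub] at this
  exact sub_eq_zero.1 this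

variable [FiniteDimensional ℝ F]

/-- Expansion of the bracket in its second argument: a section is near `x` a combination of the
sections of a frame, to which the Leibniz rule applies. -/
theorem bracket_apply_eq_frame_right {x₀ x : M} (hx : x ∈ frameDomain EM F E x₀)
    (X Y : SmoothSections (EM := EM) F E) :
    A.bracket X Y x = A.bracket X (frameSection EM E x₀ (sectionCoord x₀ Y x)) x
      + (trivializationAt F E x₀).symmL ℝ x
        (mvfderiv 𝓘(ℝ, EM) (sectionCoord (F := F) x₀ Y) x (A.anchor x (X x))) := by
  let e := trivializationAt F E x₀
  let b := Module.finBasis ℝ F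
  let ρ := frameBump (EM := EM) F E x₀
  let c : Fin (Module.finrank ℝ F) → F →L[ℝ] ℝ := fun i =>
    LinearMap.toContinuousLinearMap (b.coord i)
  -- The coordinates of `Y` are only smooth on the domain of the trivialization; the bump function
  -- turns them into global smooth functions, as the Leibniz rule requires.
  let f : Fin (Module.finrank ℝ F) → M → ℝ := fun i y => ρ y • c i (sectionCoord x₀ Y y)
  have hf : ∀ i, ContMDiff 𝓘(ℝ, EM) 𝓘(ℝ, ℝ) ∞ (f i) := fun i => by
    refine contMDiff_of_tsupport fun y hy => ?_
    have hy' : y ∈ e.baseSet := tsupport_frameBump_subset x₀ (tsupport_smul_subset_left _ _ hy)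
    exact ρ.contMDiffAt.smul (((c i).contMDiff.contMDiffAt).comp y
      ((contMDiffOn_sectionCoord x₀ Y).contMDiffAt (e.open_baseSet.mem_nhds hy')))
  have hY : ∀ᶠ y in 𝓝 x, Y y =
      (∑ i, smulSection (f i) (hf i) (frameSection EM E x₀ (b i))) y := by
    filter_upwards [(isOpen_frameDomain x₀).mem_nhds hx] with y hy
    rw [sum_apply]
    change _ = ∑ i, f i y • frameSection EM E x₀ (b i) y
    have h2 : ∀ i, f i y • frameSection EM E x₀ (b i) y
        = e.symmL ℝ y (b.repr (sectionCoord x₀ Y y) i • b i) := fun i => by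
      rw [frameSection_apply_of_mem hy, map_smul]
      simp [f, ρ, c, frameBump_eq_one hy, e]
    rw [Finset.sum_congr rfl fun i _ => h2 i, ← map_sum, b.sum_repr]
    exact (e.symmL_continuousLinearMapAt (frameDomain_subset_baseSet x₀ hy) (Y y)).symm
  have hc : MDifferentiableAt 𝓘(ℝ, EM) 𝓘(ℝ, F) (sectionCoord (F := F) x₀ Y) x :=
    mdifferentiableAt_sectionCoord Y (frameDomain_subset_baseSet x₀ hx)
  have hfx : ∀ i v, mvfderiv 𝓘(ℝ, EM) (f i) x v
      = c i (mvfderiv 𝓘(ℝ, EM) (sectionCoord (F := F) x₀ Y) x v) := fun i v => by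
    rw [← mvfderiv_clm_comp (c i) hc]
    congr 1
    refine mvfderiv_congr ?_
    filter_upwards [hx] with y hy
    simp [f, ρ, hy]
  rw [A.bracket_congr_right hY, map_sum, sum_apply]
  simp only [A.leibniz, Finset.sum_add_distrib, hfx]
  congr 1
  · have h3 : frameSection EM E x₀ (sectionCoord x₀ Y x)
        = ∑ i, b.repr (sectionCoord x₀ Y x) i • frameSection EM E x₀ (b i) := by
      conv_lhs => rw [← b.sum_repr (sectionCoord x₀ Y x)]
      change frameSectionₗ EM E x₀ _ = _
      rw [map_sum]
      simp only [map_smul]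
      rfl
    rw [h3, map_sum, sum_apply]
    refine Finset.sum_congr rfl fun i _ => ?_
    rw [map_smul]
    simp [f, ρ, frameBump_eq_one hx, c]
  · have h2 : ∀ i (v : F), c i v • frameSection EM E x₀ (b i) x
        = e.symmL ℝ x (b.repr v i • b i) := fun i v => by
      rw [frameSection_apply_of_mem hx, map_smul]
      simp [c, e]
    simp only [h2]
    rw [← map_sum, b.sum_repr]

/-- The local expression of the bracket of two sections in the frame of constant coordinates in
the preferred trivialization at `x₀`. -/
theorem bracket_apply_eq_frame {x₀ x : M} (hx : x ∈ frameDomain EM F E x₀)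
    (X Y : SmoothSections (EM := EM) F E) :
    A.bracket X Y x = A.bracket (frameSection EM E x₀ (sectionCoord x₀ X x))
        (frameSection EM E x₀ (sectionCoord x₀ Y x)) x
      + (trivializationAt F E x₀).symmL ℝ x
        (mvfderiv 𝓘(ℝ, EM) (sectionCoord (F := F) x₀ Y) x (A.anchor x (X x)))
      - (trivializationAt F E x₀).symmL ℝ x
        (mvfderiv 𝓘(ℝ, EM) (sectionCoord (F := F) x₀ X) x (A.anchor x (Y x))) := by
  rw [A.bracket_apply_eq_frame_right hx X Y, A.bracket_swap X,
    ContMDiffSection.coe_neg, Pi.neg_apply, A.bracket_apply_eq_frame_right hx _ X,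
    frameSection_sectionCoord hx,
    A.bracket_swap (frameSection EM E x₀ (sectionCoord x₀ X x)),
    ContMDiffSection.coe_neg, Pi.neg_apply]
  abel

end LieAlgebroid

namespace LieAlgebroid

variable {EM : Type*} [NormedAddCommGroup EM] [NormedSpace ℝ EM]
  {M : Type*} [TopologicalSpace M] [ChartedSpace EM M] [IsManifold 𝓘(ℝ, EM) ∞ M]
  {F : Type*} [NormedAddCommGroup F] [NormedSpace ℝ F]
  {E : M → Type*} [∀ x, AddCommGroup (E x)] [∀ x, Module ℝ (E x)]
  [∀ x, TopologicalSpace (E x)] [TopologicalSpace (TotalSpace F E)]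
  [FiberBundle F E] [VectorBundle ℝ F E] [ContMDiffVectorBundle ∞ F E 𝓘(ℝ, EM)]

/-! ### Fibre coordinates on the dual bundle and the symplectic section -/

variable (F) in
/-- The coordinates of the fibre component of a point of `E*`, dual to the preferred trivialization
of `E` at `x₀`. -/
def fiberCoord (x₀ : M) (a : DualBundle F E) : F →L[ℝ] ℝ :=
  a.2.comp ((trivializationAt F E x₀).symmL ℝ a.proj)

theorem trivializationAt_dual_apply (x₀ : M) (a : DualBundle F E) :
    trivializationAt (F →L[ℝ] ℝ) (fun x : M => E x →L[ℝ] ℝ) x₀ a = (a.proj, fiberCoord F x₀ a) := by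
  refine Prod.ext rfl ?_
  ext u
  simp [fiberCoord, hom_trivializationAt_apply, ContinuousLinearMap.inCoordinates]

theorem trivializationAt_dual_baseSet (x₀ : M) :
    (trivializationAt (F →L[ℝ] ℝ) (fun x : M => E x →L[ℝ] ℝ) x₀).baseSet
      = (trivializationAt F E x₀).baseSet := by
  simp

theorem contMDiffAt_fiberCoord {x₀ : M} {a : DualBundle F E}
    (ha : a.proj ∈ (trivializationAt F E x₀).baseSet) :
    ContMDiffAt (𝓘(ℝ, EM).prod 𝓘(ℝ, F →L[ℝ] ℝ)) 𝓘(ℝ, F →L[ℝ] ℝ) ∞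
      (fiberCoord F x₀ : DualBundle F E → _) a := by
  have h := ((trivializationAt (F →L[ℝ] ℝ) (fun x : M => E x →L[ℝ] ℝ) x₀).contMDiffAt_iff
    (IM := 𝓘(ℝ, EM).prod 𝓘(ℝ, F →L[ℝ] ℝ)) (IB := 𝓘(ℝ, EM)) (n := ∞) (f := id) (x₀ := a)
    (by rw [Trivialization.mem_source, trivializationAt_dual_baseSet]; exact ha)).1 contMDiffAt_id
  refine h.2.congr_of_eventuallyEq (Eventually.of_forall fun a' => ?_)
  simp [trivializationAt_dual_apply]

namespace ProlongationSection

variable {A : LieAlgebroid (EM := EM) F E}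

theorem coord_eq (Z : A.ProlongationSection) {x₀ : M} {a : DualBundle F E}
    (ha : a.proj ∈ (trivializationAt F E x₀).baseSet) :
    Z.coord x₀ a = (trivializationAt F E x₀).continuousLinearMapAt ℝ a.proj (Z.fst a) := by
  simp [coord, Trivialization.continuousLinearMapAt_apply_of_mem, ha]

theorem symmL_coord (Z : A.ProlongationSection) {x₀ : M} {a : DualBundle F E}
    (ha : a.proj ∈ (trivializationAt F E x₀).baseSet) :
    (trivializationAt F E x₀).symmL ℝ a.proj (Z.coord x₀ a) = Z.fst a := by
  rw [coord_eq Z ha, Trivialization.symmL_continuousLinearMapAt _ ha]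

theorem contMDiffAt_coord (Z : A.ProlongationSection) {x₀ : M} {a : DualBundle F E}
    (ha : a.proj ∈ (trivializationAt F E x₀).baseSet) :
    ContMDiffAt (𝓘(ℝ, EM).prod 𝓘(ℝ, F →L[ℝ] ℝ)) 𝓘(ℝ, F) ∞ (Z.coord x₀) a :=
  (((trivializationAt F E x₀).contMDiffAt_iff
    (by rw [Trivialization.mem_source]; exact ha)).1 (Z.smooth_fst a)).2

theorem mdifferentiableAt_coord (Z : A.ProlongationSection) {x₀ : M} {a : DualBundle F E}
    (ha : a.proj ∈ (trivializationAt F E x₀).baseSet) :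
    MDifferentiableAt (𝓘(ℝ, EM).prod 𝓘(ℝ, F →L[ℝ] ℝ)) 𝓘(ℝ, F) (Z.coord x₀) a :=
  (Z.contMDiffAt_coord ha).mdifferentiableAt (by simp)

theorem projDeriv_anchorField (Z : A.ProlongationSection) (a : DualBundle F E) :
    projDeriv a (Z.anchorField a) = A.anchor a.proj (Z.fst a) := (Z.val a).2.symm

end ProlongationSection

theorem mdifferentiableAt_proj (a : DualBundle F E) :
    MDifferentiableAt (𝓘(ℝ, EM).prod 𝓘(ℝ, F →L[ℝ] ℝ)) 𝓘(ℝ, EM)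
      (fun a' : DualBundle F E => a'.proj) a :=
  (contMDiffAt_proj (n := ∞) (IB := 𝓘(ℝ, EM)) (fun x : M => E x →L[ℝ] ℝ)).mdifferentiableAt
    (by simp)

theorem eventually_proj_mem {s : Set M} (hs : IsOpen s) {a : DualBundle F E} (ha : a.proj ∈ s) :
    ∀ᶠ a' : DualBundle F E in 𝓝 a, a'.proj ∈ s :=
  (FiberBundle.continuous_proj (F →L[ℝ] ℝ) (fun x : M => E x →L[ℝ] ℝ)).continuousAt
    (hs.mem_nhds ha)

variable (F E) in
/-- The change of coordinates from the preferred trivialization at `x₀` to the one at `x₁`. -/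
def transition (x₀ x₁ : M) (x : M) : F →L[ℝ] F :=
  (trivializationAt F E x₀).coordChangeL ℝ (trivializationAt F E x₁) x

theorem mdifferentiableAt_transition {x₀ x₁ x : M} (h₀ : x ∈ (trivializationAt F E x₀).baseSet)
    (h₁ : x ∈ (trivializationAt F E x₁).baseSet) :
    MDifferentiableAt 𝓘(ℝ, EM) 𝓘(ℝ, F →L[ℝ] F) (transition F E x₀ x₁) x :=
  (contMDiffAt_coordChangeL (n := ∞) h₀ h₁).mdifferentiableAt (by simp)

theorem continuousLinearMapAt_symmL_eq {x₀ x₁ x : M}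
    (h₀ : x ∈ (trivializationAt F E x₀).baseSet) (h₁ : x ∈ (trivializationAt F E x₁).baseSet)
    (u : F) : (trivializationAt F E x₁).continuousLinearMapAt ℝ x
      ((trivializationAt F E x₀).symmL ℝ x u)
      = transition F E x₀ x₁ x u := by
  rw [transition, ContinuousLinearEquiv.coe_coe, Trivialization.coordChangeL_apply _ _ ⟨h₀, h₁⟩,
    Trivialization.continuousLinearMapAt_apply_of_mem _ _ h₁, Trivialization.symmL_apply _ h₀]

theorem symmL_transition {x₀ x₁ x : M}
    (h₀ : x ∈ (trivializationAt F E x₀).baseSet) (h₁ : x ∈ (trivializationAt F E x₁).baseSet)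
    (u : F) : (trivializationAt F E x₁).symmL ℝ x
      (transition F E x₀ x₁ x u)
      = (trivializationAt F E x₀).symmL ℝ x u := by
  rw [← continuousLinearMapAt_symmL_eq h₀ h₁, Trivialization.symmL_continuousLinearMapAt _ h₁]

namespace ProlongationSection

variable {A : LieAlgebroid (EM := EM) F E}

/-- Under a change of trivialization, the derivative of the coordinates of a section of the
prolongation picks up the derivative of the transition functions. -/
theorem mvfderiv_coord_transition (Z : A.ProlongationSection) {x₀ x₁ : M} {a : DualBundle F E}
    (h₀ : a.proj ∈ (trivializationAt F E x₀).baseSet)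
    (h₁ : a.proj ∈ (trivializationAt F E x₁).baseSet)
    (w : TangentSpace (𝓘(ℝ, EM).prod 𝓘(ℝ, F →L[ℝ] ℝ)) a) :
    mvfderiv (𝓘(ℝ, EM).prod 𝓘(ℝ, F →L[ℝ] ℝ)) (Z.coord x₁) a w =
      transition F E x₀ x₁ a.proj
        (mvfderiv (𝓘(ℝ, EM).prod 𝓘(ℝ, F →L[ℝ] ℝ)) (Z.coord x₀) a w)
      + mvfderiv 𝓘(ℝ, EM) (transition F E x₀ x₁) a.proj (projDeriv a w) (Z.coord x₀ a) := by
  have hev : Z.coord x₁ =ᶠ[𝓝 a] fun a' => transition F E x₀ x₁ a'.proj (Z.coord x₀ a') := by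
    filter_upwards [eventually_proj_mem (trivializationAt F E x₀).open_baseSet h₀,
      eventually_proj_mem (trivializationAt F E x₁).open_baseSet h₁] with a' h h'
    rw [Z.coord_eq h', ← Z.symmL_coord h, continuousLinearMapAt_symmL_eq h h']
  have hT := mdifferentiableAt_transition (EM := EM) h₀ h₁
  rw [mvfderiv_congr hev, mvfderiv_clm_apply (g := fun a' => transition F E x₀ x₁ a'.proj)
    (hT.comp a (mdifferentiableAt_proj a)) (Z.mdifferentiableAt_coord h₀),
    mvfderiv_comp_vector hT (mdifferentiableAt_proj a)]
  rfl

variable [FiniteDimensional ℝ EM] [T2Space M] [FiniteDimensional ℝ F]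

/-- The first component of the bracket of the prolongation may be computed in the frame of any
preferred trivialization, not only the one centred at the base point. -/
theorem bracket_fst_eq (Y Z : A.ProlongationSection) {x₀ : M} {a : DualBundle F E}
    (ha : a.proj ∈ frameDomain EM F E x₀) :
    (Y.bracket Z a).1 = A.bracket (frameSection EM E x₀ (Y.coord x₀ a))
        (frameSection EM E x₀ (Z.coord x₀ a)) a.proj
      + (trivializationAt F E x₀).symmL ℝ a.proj
        (mvfderiv (𝓘(ℝ, EM).prod 𝓘(ℝ, F →L[ℝ] ℝ)) (Z.coord x₀) a (Y.anchorField a))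
      - (trivializationAt F E x₀).symmL ℝ a.proj
        (mvfderiv (𝓘(ℝ, EM).prod 𝓘(ℝ, F →L[ℝ] ℝ)) (Y.coord x₀) a (Z.anchorField a)) := by
  have h₀ := frameDomain_subset_baseSet x₀ ha
  have h₁ : a.proj ∈ (trivializationAt F E a.proj).baseSet :=
    FiberBundle.mem_baseSet_trivializationAt' a.proj
  have hT := mdifferentiableAt_transition (EM := EM) h₀ h₁
  -- In the trivialization centred at the base point, a section with constant coordinates at `x₀`
  -- has coordinates given by the transition functions; the derivatives of these cancel the ones
  -- of `mvfderiv_coord_transition`.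
  have hcoord : ∀ u : F, sectionCoord (F := F) a.proj (frameSection EM E x₀ u) =ᶠ[𝓝 a.proj]
      fun y => transition F E x₀ a.proj y u := fun u => by
    filter_upwards [(isOpen_frameDomain x₀).mem_nhds ha,
      (trivializationAt F E a.proj).open_baseSet.mem_nhds h₁] with y hy hy'
    rw [sectionCoord, frameSection_apply_of_mem hy,
      continuousLinearMapAt_symmL_eq (frameDomain_subset_baseSet x₀ hy) hy']
  have hdcoord : ∀ (u : F) v, mvfderiv 𝓘(ℝ, EM)
      (sectionCoord (F := F) a.proj (frameSection EM E x₀ u)) a.proj v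
      = mvfderiv 𝓘(ℝ, EM) (transition F E x₀ a.proj) a.proj v u := fun u v => by
    rw [mvfderiv_congr (hcoord u), mvfderiv_apply_const hT]
  have hval : ∀ W : A.ProlongationSection,
      frameSection EM E x₀ (W.coord x₀ a) a.proj = W.fst a := fun W => by
    rw [frameSection_apply_of_mem ha, W.symmL_coord h₀]
  have hc : ∀ W : A.ProlongationSection,
      sectionCoord a.proj (frameSection EM E x₀ (W.coord x₀ a)) a.proj = W.coord a.proj a :=
    fun W => by rw [sectionCoord, hval, W.coord_eq h₁]
  rw [A.bracket_apply_eq_frame (mem_frameDomain_self a.proj)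
    (frameSection EM E x₀ (Y.coord x₀ a)), hc, hc, hval, hval, hdcoord, hdcoord]
  simp only [bracket, coordDeriv]
  rw [← Trivialization.symmL_apply (R := ℝ) _ h₁, ← Trivialization.symmL_apply (R := ℝ) _ h₁,
    Z.mvfderiv_coord_transition h₀ h₁, Y.mvfderiv_coord_transition h₀ h₁, map_add, map_add,
    symmL_transition h₀ h₁, symmL_transition h₀ h₁, projDeriv_anchorField,
    projDeriv_anchorField]
  abel

/-- The derivative of the pairing of the Liouville section with a section of the prolongation, which
near `a` is the pairing of the coordinates of both. -/
theorem mvfderiv_liouville (Z : A.ProlongationSection) {x₀ : M} {a : DualBundle F E}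
    (ha : a.proj ∈ (trivializationAt F E x₀).baseSet)
    (w : TangentSpace (𝓘(ℝ, EM).prod 𝓘(ℝ, F →L[ℝ] ℝ)) a) :
    mvfderiv (𝓘(ℝ, EM).prod 𝓘(ℝ, F →L[ℝ] ℝ))
        (fun a' => a'.2 (Z.fst a')) a w
      = fiberCoord F x₀ a
          (mvfderiv (𝓘(ℝ, EM).prod 𝓘(ℝ, F →L[ℝ] ℝ)) (Z.coord x₀) a w)
        + mvfderiv (𝓘(ℝ, EM).prod 𝓘(ℝ, F →L[ℝ] ℝ)) (fiberCoord F x₀) a w (Z.coord x₀ a) := by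
  have hev : (fun a' => a'.2 (Z.fst a')) =ᶠ[𝓝 a]
      fun a' => fiberCoord F x₀ a' (Z.coord x₀ a') := by
    filter_upwards [eventually_proj_mem (trivializationAt F E x₀).open_baseSet ha]
      with a' h
    rw [fiberCoord, ContinuousLinearMap.comp_apply, Z.symmL_coord h]
  rw [mvfderiv_congr hev, mvfderiv_clm_apply
    ((contMDiffAt_fiberCoord ha).mdifferentiableAt (by simp)) (Z.mdifferentiableAt_coord ha)]

end ProlongationSection

variable {A : LieAlgebroid (EM := EM) F E}
variable [FiniteDimensional ℝ EM] [T2Space M] [FiniteDimensional ℝ F]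

/-- The canonical symplectic section in coordinates: with `y`, `z` the coordinates of the first
components of `Y`, `Z` and `p` the fibre coordinates on `E*`, its value at `a` is
`⟨dp(Z'), y⟩ - ⟨dp(Y'), z⟩ + a([e_y, e_z])`. In particular it only depends on the values of `Y` and
`Z` at `a`, and the bracket of vector fields on `E*` plays no role. -/
theorem symplecticSection_eq (Y Z : A.ProlongationSection) {x₀ : M} {a : DualBundle F E}
    (ha : a.proj ∈ frameDomain EM F E x₀) :
    symplecticSection Y Z a =
      mvfderiv (𝓘(ℝ, EM).prod 𝓘(ℝ, F →L[ℝ] ℝ)) (fiberCoord F x₀) a (Z.anchorField a)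
          (Y.coord x₀ a)
        - mvfderiv (𝓘(ℝ, EM).prod 𝓘(ℝ, F →L[ℝ] ℝ)) (fiberCoord F x₀) a (Y.anchorField a)
          (Z.coord x₀ a)
        + a.2 (A.bracket (frameSection EM E x₀ (Y.coord x₀ a))
          (frameSection EM E x₀ (Z.coord x₀ a)) a.proj) := by
  have h₀ := frameDomain_subset_baseSet x₀ ha
  have hP : ∀ u, a.2 ((trivializationAt F E x₀).symmL ℝ a.proj u) = fiberCoord F x₀ a u :=
    fun u => rfl
  have hd : symplecticSection Y Z a = -(mvfderiv (𝓘(ℝ, EM).prod 𝓘(ℝ, F →L[ℝ] ℝ))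
      (fun a' => a'.2 (Z.fst a')) a (Y.anchorField a)
      - mvfderiv (𝓘(ℝ, EM).prod 𝓘(ℝ, F →L[ℝ] ℝ)) (fun a' => a'.2 (Y.fst a')) a (Z.anchorField a)
      - a.2 (Y.bracket Z a).1) := rfl
  rw [hd, Z.mvfderiv_liouville h₀, Y.mvfderiv_liouville h₀,
    Y.bracket_fst_eq Z ha, map_sub, map_add, hP, hP]
  ring

end LieAlgebroid

namespace LieAlgebroid

variable {EM : Type*} [NormedAddCommGroup EM] [NormedSpace ℝ EM]
  {M : Type*} [TopologicalSpace M] [ChartedSpace EM M] [IsManifold 𝓘(ℝ, EM) ∞ M]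
  {F : Type*} [NormedAddCommGroup F] [NormedSpace ℝ F]
  {E : M → Type*} [∀ x, AddCommGroup (E x)] [∀ x, Module ℝ (E x)]
  [∀ x, TopologicalSpace (E x)] [TopologicalSpace (TotalSpace F E)]
  [FiberBundle F E] [VectorBundle ℝ F E] [ContMDiffVectorBundle ∞ F E 𝓘(ℝ, EM)]

/-! ### Tangent vectors of the dual bundle and local sections of the prolongation -/

variable (EM F E) in
/-- The domain over which both the preferred trivialization of `E` and the preferred chart of `M`
at `x₀` are defined. -/
def coordDomain (x₀ : M) : Set M := (trivializationAt F E x₀).baseSet ∩ (chartAt EM x₀).source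

theorem isOpen_coordDomain (x₀ : M) : IsOpen (coordDomain EM F E x₀) :=
  (trivializationAt F E x₀).open_baseSet.inter (chartAt EM x₀).open_source

variable (EM E) in
/-- The preferred trivialization of the tangent bundle of `E*` at the zero covector over `x₀`. -/
def dualTangentTriv (x₀ : M) : Trivialization (EM × (F →L[ℝ] ℝ))
    (π (EM × (F →L[ℝ] ℝ))
      (TangentSpace (𝓘(ℝ, EM).prod 𝓘(ℝ, F →L[ℝ] ℝ)) : DualBundle F E → Type _)) :=
  trivializationAt (EM × (F →L[ℝ] ℝ)) (TangentSpace (𝓘(ℝ, EM).prod 𝓘(ℝ, F →L[ℝ] ℝ)))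
    (⟨x₀, 0⟩ : DualBundle F E)

instance (x₀ : M) : MemTrivializationAtlas (dualTangentTriv EM E x₀ : Trivialization
    (EM × (F →L[ℝ] ℝ)) (π (EM × (F →L[ℝ] ℝ))
      (TangentSpace (𝓘(ℝ, EM).prod 𝓘(ℝ, F →L[ℝ] ℝ)) : DualBundle F E → Type _))) := by
  unfold dualTangentTriv; infer_instance

theorem mem_dualTangentTriv_baseSet {x₀ : M} {a : DualBundle F E} :
    a ∈ (dualTangentTriv EM E x₀).baseSet ↔ a.proj ∈ coordDomain EM F E x₀ := by
  rw [dualTangentTriv, TangentBundle.trivializationAt_baseSet, FiberBundle.chartedSpace_chartAt]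
  simp only [OpenPartialHomeomorph.trans_source, mem_inter_iff, Set.mem_preimage,
    OpenPartialHomeomorph.prod_source, mem_prod, coordDomain, trivializationAt_dual_apply,
    Trivialization.mem_source, Trivialization.coe_coe, trivializationAt_dual_baseSet]
  simp

/-- The preferred trivialization of the tangent bundle of `E*` at the zero covector over `x₀` splits
a tangent vector into its projection to `M` and the derivative of the fibre coordinates. -/
theorem dualTangentTriv_continuousLinearMapAt {x₀ : M} {a : DualBundle F E}
    (ha : a.proj ∈ coordDomain EM F E x₀)
    (w : TangentSpace (𝓘(ℝ, EM).prod 𝓘(ℝ, F →L[ℝ] ℝ)) a) :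
    (dualTangentTriv EM E x₀).continuousLinearMapAt ℝ a w =
      ((trivializationAt EM (TangentSpace 𝓘(ℝ, EM)) x₀).continuousLinearMapAt ℝ a.proj
          (projDeriv a w),
        mvfderiv (𝓘(ℝ, EM).prod 𝓘(ℝ, F →L[ℝ] ℝ)) (fiberCoord F x₀) a w) := by
  have hm := (mem_dualTangentTriv_baseSet (x₀ := x₀)).2 ha
  rw [dualTangentTriv, TangentBundle.trivializationAt_baseSet] at hm
  change (trivializationAt (EM × (F →L[ℝ] ℝ)) (TangentSpace (𝓘(ℝ, EM).prod 𝓘(ℝ, F →L[ℝ] ℝ)))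
    (⟨x₀, 0⟩ : DualBundle F E)).continuousLinearMapAt ℝ a w = _
  rw [TangentBundle.continuousLinearMapAt_trivializationAt hm,
    TangentBundle.continuousLinearMapAt_trivializationAt ha.2]
  have hfun : (extChartAt (𝓘(ℝ, EM).prod 𝓘(ℝ, F →L[ℝ] ℝ)) (⟨x₀, 0⟩ : DualBundle F E)
      : DualBundle F E → EM × (F →L[ℝ] ℝ)) =
      fun a' => (extChartAt 𝓘(ℝ, EM) x₀ a'.proj, fiberCoord F x₀ a') := by
    funext a'
    rw [FiberBundle.extChartAt]
    simp [trivializationAt_dual_apply]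
  have h1 : MDifferentiableAt (𝓘(ℝ, EM).prod 𝓘(ℝ, F →L[ℝ] ℝ)) 𝓘(ℝ, EM)
      (fun a' : DualBundle F E => extChartAt 𝓘(ℝ, EM) x₀ a'.proj) a :=
    (mdifferentiableAt_extChartAt ha.2).comp a (mdifferentiableAt_proj a)
  have h2 := (contMDiffAt_fiberCoord (EM := EM) ha.1).mdifferentiableAt (by simp)
  have h3 := h1.prodMk_space h2
  rw [hfun]
  refine Prod.ext ?_ ?_
  · refine (mvfderiv_clm_comp (ContinuousLinearMap.fst ℝ EM (F →L[ℝ] ℝ)) h3 w).symm.trans ?_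
    exact mfderiv_comp_apply a (mdifferentiableAt_extChartAt ha.2) (mdifferentiableAt_proj a) w
  · exact (mvfderiv_clm_comp (ContinuousLinearMap.snd ℝ EM (F →L[ℝ] ℝ)) h3 w).symm

/-- A tangent vector of `E*` is determined by its projection and the derivative of the fibre
coordinates. -/
theorem tangent_ext {x₀ : M} {a : DualBundle F E} (ha : a.proj ∈ coordDomain EM F E x₀)
    {w w' : TangentSpace (𝓘(ℝ, EM).prod 𝓘(ℝ, F →L[ℝ] ℝ)) a} (h : projDeriv a w = projDeriv a w')
    (h' : mvfderiv (𝓘(ℝ, EM).prod 𝓘(ℝ, F →L[ℝ] ℝ)) (fiberCoord F x₀) a w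
      = mvfderiv (𝓘(ℝ, EM).prod 𝓘(ℝ, F →L[ℝ] ℝ)) (fiberCoord F x₀) a w') : w = w' := by
  have hm := (mem_dualTangentTriv_baseSet (x₀ := x₀)).2 ha
  rw [← (dualTangentTriv EM E x₀).symmL_continuousLinearMapAt (R := ℝ) hm w,
    ← (dualTangentTriv EM E x₀).symmL_continuousLinearMapAt (R := ℝ) hm w',
    dualTangentTriv_continuousLinearMapAt ha, dualTangentTriv_continuousLinearMapAt ha, h, h']

variable (A : LieAlgebroid (EM := EM) F E)

/-- The anchor read in the preferred trivializations of `E` and of `TM` at `x₀`. -/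
def anchorCoord (x₀ x : M) : F →L[ℝ] EM :=
  ((trivializationAt EM (TangentSpace 𝓘(ℝ, EM)) x₀).continuousLinearMapAt ℝ x).comp
    ((A.anchor x).comp ((trivializationAt F E x₀).symmL ℝ x))

theorem contMDiffAt_anchorCoord {x₀ x : M} (hx : x ∈ coordDomain EM F E x₀) :
    ContMDiffAt 𝓘(ℝ, EM) 𝓘(ℝ, F →L[ℝ] EM) ∞ (A.anchorCoord x₀) x := by
  have h := ((trivializationAt (F →L[ℝ] EM)
    (fun x : M => E x →L[ℝ] TangentSpace 𝓘(ℝ, EM) x) x₀).contMDiffAt_section_iff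
    (IB := 𝓘(ℝ, EM)) (n := ∞) (s := A.anchor) (x₀ := x)
    (by rw [hom_trivializationAt_baseSet, TangentBundle.trivializationAt_baseSet]; exact hx)).1
    A.anchor.contMDiff.contMDiffAt
  exact h

/-- The tangent vector of `E*` at `a` with projection `ρ(e_u)` and fibre coordinates `φ`, in the
coordinates at `x₀`. -/
def liftVector (x₀ : M) (a : DualBundle F E) :
    F × (F →L[ℝ] ℝ) →L[ℝ] TangentSpace (𝓘(ℝ, EM).prod 𝓘(ℝ, F →L[ℝ] ℝ)) a :=
  ((dualTangentTriv EM E x₀).symmL ℝ a).comp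
    ((A.anchorCoord x₀ a.proj).prodMap (ContinuousLinearMap.id ℝ (F →L[ℝ] ℝ)))

theorem projDeriv_liftVector {x₀ : M} {a : DualBundle F E} (ha : a.proj ∈ coordDomain EM F E x₀)
    (u : F × (F →L[ℝ] ℝ)) : projDeriv a (A.liftVector x₀ a u)
      = A.anchor a.proj ((trivializationAt F E x₀).symmL ℝ a.proj u.1) := by
  have h := dualTangentTriv_continuousLinearMapAt ha (A.liftVector x₀ a u)
  rw [liftVector, ContinuousLinearMap.comp_apply,
    Trivialization.continuousLinearMapAt_symmL (R := ℝ) (dualTangentTriv EM E x₀)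
    (mem_dualTangentTriv_baseSet.2 ha)] at h
  have h1 := congrArg Prod.fst h
  have hx : a.proj ∈ (trivializationAt EM (TangentSpace 𝓘(ℝ, EM)) x₀).baseSet := by
    rw [TangentBundle.trivializationAt_baseSet]; exact ha.2
  have h2 := congrArg ((trivializationAt EM (TangentSpace 𝓘(ℝ, EM)) x₀).symmL ℝ a.proj) h1
  rw [Trivialization.symmL_continuousLinearMapAt _ hx] at h2
  refine h2.symm.trans ?_
  exact Trivialization.symmL_continuousLinearMapAt _ hx _

theorem mvfderiv_fiberCoord_liftVector {x₀ : M} {a : DualBundle F E}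
    (ha : a.proj ∈ coordDomain EM F E x₀) (u : F × (F →L[ℝ] ℝ)) :
    mvfderiv (𝓘(ℝ, EM).prod 𝓘(ℝ, F →L[ℝ] ℝ)) (fiberCoord F x₀) a (A.liftVector x₀ a u) = u.2 := by
  have h := dualTangentTriv_continuousLinearMapAt ha (A.liftVector x₀ a u)
  rw [liftVector, ContinuousLinearMap.comp_apply,
    Trivialization.continuousLinearMapAt_symmL (R := ℝ) (dualTangentTriv EM E x₀)
    (mem_dualTangentTriv_baseSet.2 ha)] at h
  exact (congrArg Prod.snd h).symm

variable [FiniteDimensional ℝ EM] [T2Space M]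

theorem tsupport_frameBump_subset_coordDomain (x₀ : M) :
    tsupport (frameBump (EM := EM) F E x₀) ⊆ coordDomain EM F E x₀ :=
  subset_inter (tsupport_frameBump_subset x₀)
    (frameBump (EM := EM) F E x₀).tsupport_subset_chartAt_source

theorem frameDomain_subset_coordDomain (x₀ : M) :
    frameDomain EM F E x₀ ⊆ coordDomain EM F E x₀ :=
  (frameDomain_subset_tsupport x₀).trans (tsupport_frameBump_subset_coordDomain x₀)

/-- The global section of the prolongation which, over `frameDomain EM F E x₀`, has first component
with coordinates `y` and vector field with fibre coordinates `φ`. -/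
def localSection (x₀ : M) {y : DualBundle F E → F} {φ : DualBundle F E → F →L[ℝ] ℝ}
    (hy : ContMDiff (𝓘(ℝ, EM).prod 𝓘(ℝ, F →L[ℝ] ℝ)) 𝓘(ℝ, F) ∞ y)
    (hφ : ContMDiff (𝓘(ℝ, EM).prod 𝓘(ℝ, F →L[ℝ] ℝ)) 𝓘(ℝ, F →L[ℝ] ℝ) ∞ φ) :
    A.ProlongationSection where
  val a := ⟨(frameSection EM E x₀ (y a) a.proj,
      frameBump (EM := EM) F E x₀ a.proj • A.liftVector x₀ a (y a, φ a)), by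
    change A.anchor a.proj _ = projDeriv a _
    rw [frameSection_apply, ContinuousLinearMap.map_smul, ContinuousLinearMap.map_smul]
    by_cases ha : a.proj ∈ tsupport (frameBump (EM := EM) F E x₀)
    · rw [A.projDeriv_liftVector (tsupport_frameBump_subset_coordDomain x₀ ha)]
    · rw [image_eq_zero_of_notMem_tsupport ha, zero_smul, zero_smul]⟩
  smooth_fst a := by
    by_cases ha : a.proj ∈ (trivializationAt F E x₀).baseSet
    · refine ((trivializationAt F E x₀).contMDiffAt_iff
        (by rw [Trivialization.mem_source]; exact ha)).2 ⟨contMDiffAt_proj _, ?_⟩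
      have h : ContMDiffAt (𝓘(ℝ, EM).prod 𝓘(ℝ, F →L[ℝ] ℝ)) 𝓘(ℝ, F) ∞
          (fun a' : DualBundle F E => frameBump (EM := EM) F E x₀ a'.proj • y a') a :=
        (((frameBump (EM := EM) F E x₀).contMDiff.comp (contMDiff_proj _)).smul hy) a
      refine h.congr_of_eventuallyEq ?_
      filter_upwards [eventually_proj_mem (trivializationAt F E x₀).open_baseSet ha] with a' ha'
      rw [frameSection_apply, ← map_smul, Trivialization.symmL_apply _ ha',
        Trivialization.apply_mk_symm _ ha']
    · have hz : ContMDiff (𝓘(ℝ, EM).prod 𝓘(ℝ, F →L[ℝ] ℝ)) (𝓘(ℝ, EM).prod 𝓘(ℝ, F)) ∞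
          (fun a' : DualBundle F E => (zeroSection F E a'.proj)) :=
        (contMDiff_zeroSection ℝ E).comp (contMDiff_proj _)
      refine (hz a).congr_of_eventuallyEq ?_
      have ht : a.proj ∈ (tsupport (frameBump (EM := EM) F E x₀))ᶜ :=
        fun h => ha (tsupport_frameBump_subset x₀ h)
      filter_upwards [eventually_proj_mem (isClosed_tsupport _).isOpen_compl ht] with a' ha'
      simp only [frameSection_apply, image_eq_zero_of_notMem_tsupport ha', zero_smul]
      rfl
  smooth_snd := by
    have hopen : IsOpen {a : DualBundle F E | a.proj ∈ coordDomain EM F E x₀} :=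
      isOpen_iff_eventually.2 fun a ha => eventually_proj_mem (isOpen_coordDomain x₀) ha
    refine ContMDiffOn.smul_section_of_tsupport
      (ψ := fun a : DualBundle F E => frameBump (EM := EM) F E x₀ a.proj)
      (s := fun a => A.liftVector x₀ a (y a, φ a))
      (u := {a : DualBundle F E | a.proj ∈ coordDomain EM F E x₀})
      ((frameBump (EM := EM) F E x₀).contMDiff.comp (contMDiff_proj _)).contMDiffOn hopen ?_ ?_
    · exact (tsupport_comp_subset_preimage _ (FiberBundle.continuous_proj _ _)).trans
        (preimage_mono (tsupport_frameBump_subset_coordDomain x₀))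
    · intro a ha
      refine ContMDiffAt.contMDiffWithinAt ?_
      refine ((dualTangentTriv EM E x₀).contMDiffAt_section_iff
        (mem_dualTangentTriv_baseSet.2 ha)).2 ?_
      have h : ContMDiffAt (𝓘(ℝ, EM).prod 𝓘(ℝ, F →L[ℝ] ℝ)) 𝓘(ℝ, EM × (F →L[ℝ] ℝ)) ∞
          (fun a' => (A.anchorCoord x₀ a'.proj (y a'), φ a')) a :=
        (((A.contMDiffAt_anchorCoord ha).comp a (contMDiffAt_proj _)).clm_apply
          (hy a)).prodMk_space (hφ a)
      refine h.congr_of_eventuallyEq ?_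
      filter_upwards [eventually_proj_mem (isOpen_coordDomain x₀) ha] with a' ha'
      have := Trivialization.continuousLinearMapAt_symmL (R := ℝ) (dualTangentTriv EM E x₀)
        (mem_dualTangentTriv_baseSet.2 ha') (A.anchorCoord x₀ a'.proj (y a'), φ a')
      rw [Trivialization.continuousLinearMapAt_apply_of_mem ℝ (dualTangentTriv EM E x₀)
        (mem_dualTangentTriv_baseSet.2 ha')] at this
      exact this

section LocalSection

variable {x₀ : M} {y : DualBundle F E → F} {φ : DualBundle F E → F →L[ℝ] ℝ}
    (hy : ContMDiff (𝓘(ℝ, EM).prod 𝓘(ℝ, F →L[ℝ] ℝ)) 𝓘(ℝ, F) ∞ y)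
    (hφ : ContMDiff (𝓘(ℝ, EM).prod 𝓘(ℝ, F →L[ℝ] ℝ)) 𝓘(ℝ, F →L[ℝ] ℝ) ∞ φ) {a : DualBundle F E}

theorem coord_localSection (ha : a.proj ∈ frameDomain EM F E x₀) :
    (A.localSection x₀ hy hφ).coord x₀ a = y a := by
  rw [ProlongationSection.coord_eq _ (frameDomain_subset_baseSet x₀ ha)]
  exact sectionCoord_frameSection ha (y a)

theorem anchorField_localSection (ha : a.proj ∈ frameDomain EM F E x₀) :
    (A.localSection x₀ hy hφ).anchorField a = A.liftVector x₀ a (y a, φ a) := by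
  change frameBump (EM := EM) F E x₀ a.proj • A.liftVector x₀ a (y a, φ a) = _
  rw [frameBump_eq_one ha, one_smul]

theorem mvfderiv_fiberCoord_localSection (ha : a.proj ∈ frameDomain EM F E x₀) :
    mvfderiv (𝓘(ℝ, EM).prod 𝓘(ℝ, F →L[ℝ] ℝ)) (fiberCoord F x₀) a
      ((A.localSection x₀ hy hφ).anchorField a) = φ a := by
  rw [A.anchorField_localSection hy hφ ha,
    A.mvfderiv_fiberCoord_liftVector (frameDomain_subset_coordDomain x₀ ha)]

end LocalSection

namespace ProlongationSection

variable {A}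

/-- The vector field of a section of the prolongation is recovered from the coordinates of its
first component and the derivative of the fibre coordinates. -/
theorem anchorField_eq_liftVector (Z : A.ProlongationSection) {x₀ : M} {a : DualBundle F E}
    (ha : a.proj ∈ coordDomain EM F E x₀) :
    Z.anchorField a = A.liftVector x₀ a (Z.coord x₀ a,
      mvfderiv (𝓘(ℝ, EM).prod 𝓘(ℝ, F →L[ℝ] ℝ)) (fiberCoord F x₀) a (Z.anchorField a)) := by
  refine tangent_ext ha ?_ ?_
  · rw [A.projDeriv_liftVector ha, projDeriv_anchorField, Z.symmL_coord ha.1]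
  · rw [A.mvfderiv_fiberCoord_liftVector ha]

theorem val_eq_of_coord_eq {Y Z : A.ProlongationSection} {x₀ : M} {a : DualBundle F E}
    (ha : a.proj ∈ coordDomain EM F E x₀) (h : Y.coord x₀ a = Z.coord x₀ a)
    (h' : mvfderiv (𝓘(ℝ, EM).prod 𝓘(ℝ, F →L[ℝ] ℝ)) (fiberCoord F x₀) a (Y.anchorField a)
      = mvfderiv (𝓘(ℝ, EM).prod 𝓘(ℝ, F →L[ℝ] ℝ)) (fiberCoord F x₀) a (Z.anchorField a)) :
    Y.val a = Z.val a := by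
  refine Subtype.ext (Prod.ext ?_ ?_)
  · change Y.fst a = Z.fst a
    rw [← Y.symmL_coord ha.1, ← Z.symmL_coord ha.1, h]
  · change Y.anchorField a = Z.anchorField a
    rw [Y.anchorField_eq_liftVector ha, Z.anchorField_eq_liftVector ha, h, h']

end ProlongationSection

end LieAlgebroid

namespace LieAlgebroid

variable {EM : Type*} [NormedAddCommGroup EM] [NormedSpace ℝ EM] [FiniteDimensional ℝ EM]
  {M : Type*} [TopologicalSpace M] [ChartedSpace EM M] [IsManifold 𝓘(ℝ, EM) ∞ M] [T2Space M]
  {F : Type*} [NormedAddCommGroup F] [NormedSpace ℝ F] [FiniteDimensional ℝ F]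
  {E : M → Type*} [∀ x, AddCommGroup (E x)] [∀ x, Module ℝ (E x)]
  [∀ x, TopologicalSpace (E x)] [TopologicalSpace (TotalSpace F E)]
  [FiberBundle F E] [VectorBundle ℝ F E] [ContMDiffVectorBundle ∞ F E 𝓘(ℝ, EM)]

/-! ### Nondegeneracy and the Hamiltonian section -/

/-- The bilinear form `(u, w) ↦ a([e_u, e_w])` on the model fibre, where `e_u`, `e_w` are the
sections with constant coordinates in the preferred trivialization at `x₀`. -/
def frameBracket (A : LieAlgebroid (EM := EM) F E) (x₀ : M) (a : DualBundle F E) :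
    F →ₗ[ℝ] F →ₗ[ℝ] ℝ :=
  LinearMap.mk₂ ℝ
    (fun u w => a.2 (A.bracket (frameSection EM E x₀ u) (frameSection EM E x₀ w) a.proj))
    (fun u u' w => by simp [frameSection_add]) (fun r u w => by simp [frameSection_smul])
    (fun u w w' => by simp [frameSection_add]) (fun r u w => by simp [frameSection_smul])

theorem frameBracket_apply (A : LieAlgebroid (EM := EM) F E) (x₀ : M) (a : DualBundle F E)
    (u w : F) : A.frameBracket x₀ a u w =
      a.2 (A.bracket (frameSection EM E x₀ u) (frameSection EM E x₀ w) a.proj) := rfl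

section Pointwise

variable {A : LieAlgebroid (EM := EM) F E}

/-- The coordinate formula for the symplectic section, tested on a section with constant
coordinates. -/
theorem symplecticSection_localSection_const (Y : A.ProlongationSection) {x₀ : M}
    {a : DualBundle F E} (ha : a.proj ∈ frameDomain EM F E x₀) (z : F) (ψ : F →L[ℝ] ℝ) :
    symplecticSection Y (A.localSection x₀ (contMDiff_const (c := z)) (contMDiff_const (c := ψ))) a
      = ψ (Y.coord x₀ a)
        - mvfderiv (𝓘(ℝ, EM).prod 𝓘(ℝ, F →L[ℝ] ℝ)) (fiberCoord F x₀) a (Y.anchorField a) z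
        + A.frameBracket x₀ a (Y.coord x₀ a) z := by
  rw [symplecticSection_eq _ _ ha, A.coord_localSection _ _ ha,
    A.mvfderiv_fiberCoord_localSection _ _ ha, frameBracket_apply]

/-- The canonical symplectic section is nondegenerate: testing with vertical vectors recovers the
first component, then testing with the remaining ones recovers the vector field. -/
theorem val_eq_of_symplecticSection_eq {Y Y' : A.ProlongationSection} {a : DualBundle F E}
    (h : ∀ Z, symplecticSection Y Z a = symplecticSection Y' Z a) : Y.val a = Y'.val a := by
  have ha := mem_frameDomain_self (EM := EM) (F := F) (E := E) a.proj
  have h' : ∀ z ψ, _ := fun z ψ => h (A.localSection a.proj (contMDiff_const (c := z))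
    (contMDiff_const (c := ψ)))
  simp only [symplecticSection_localSection_const _ ha] at h'
  have hy : Y.coord a.proj a = Y'.coord a.proj a := by
    refine (SeparatingDual.eq_iff_forall_dual_eq (R := ℝ)).2 fun ψ => ?_
    have := h' 0 ψ
    simpa using this
  refine ProlongationSection.val_eq_of_coord_eq (frameDomain_subset_coordDomain _ ha) hy ?_
  ext z
  have := h' z 0
  rw [hy] at this
  simpa using this

end Pointwise

variable (A : LieAlgebroid (EM := EM) F E)

theorem contMDiff_mvfderiv_anchorField {H : DualBundle F E → ℝ}
    (hH : ContMDiff (𝓘(ℝ, EM).prod 𝓘(ℝ, F →L[ℝ] ℝ)) 𝓘(ℝ, ℝ) ∞ H) (Z : A.ProlongationSection) :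
    ContMDiff (𝓘(ℝ, EM).prod 𝓘(ℝ, F →L[ℝ] ℝ)) 𝓘(ℝ, ℝ) ∞
      (fun a => mvfderiv (𝓘(ℝ, EM).prod 𝓘(ℝ, F →L[ℝ] ℝ)) H a (Z.anchorField a)) := by
  have h1 : ContMDiff (𝓘(ℝ, EM).prod 𝓘(ℝ, F →L[ℝ] ℝ)).tangent 𝓘(ℝ, ℝ).tangent ∞
      (tangentMap (𝓘(ℝ, EM).prod 𝓘(ℝ, F →L[ℝ] ℝ)) 𝓘(ℝ, ℝ) H) :=
    hH.contMDiff_tangentMap (by simp)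
  exact (contMDiff_snd_tangentBundle_modelSpace ℝ 𝓘(ℝ, ℝ)).comp (h1.comp Z.smooth_snd)

theorem contMDiff_pairing (X : SmoothSections (EM := EM) F E) :
    ContMDiff (𝓘(ℝ, EM).prod 𝓘(ℝ, F →L[ℝ] ℝ)) 𝓘(ℝ, ℝ) ∞
      (fun a : DualBundle F E => a.2 (X a.proj)) := fun a => by
  have ha := FiberBundle.mem_baseSet_trivializationAt' (F := F) (E := E) a.proj
  have h : ContMDiffAt (𝓘(ℝ, EM).prod 𝓘(ℝ, F →L[ℝ] ℝ)) 𝓘(ℝ, ℝ) ∞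
      (fun a' : DualBundle F E => fiberCoord F a.proj a' (sectionCoord a.proj X a'.proj)) a :=
    (contMDiffAt_fiberCoord ha).clm_apply
      (((contMDiffOn_sectionCoord a.proj X).contMDiffAt
        ((trivializationAt F E a.proj).open_baseSet.mem_nhds ha)).comp a (contMDiffAt_proj _))
  refine h.congr_of_eventuallyEq ?_
  filter_upwards [eventually_proj_mem (trivializationAt F E a.proj).open_baseSet ha] with a' ha'
  rw [fiberCoord, ContinuousLinearMap.comp_apply, sectionCoord,
    Trivialization.symmL_continuousLinearMapAt _ ha']

/-- Local existence of the Hamiltonian section: the equation `i_ξ Ω = dH` is solved over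
`frameDomain EM F E x₀`, where it reads `y = ∂H/∂p` for the coordinates `y` of the first component
and `φ = a([e_y, ·]) - dH(ρ(·))` for the fibre coordinates of the vector field. -/
theorem exists_local_hamiltonianSection {H : DualBundle F E → ℝ}
    (hH : ContMDiff (𝓘(ℝ, EM).prod 𝓘(ℝ, F →L[ℝ] ℝ)) 𝓘(ℝ, ℝ) ∞ H) (x₀ : M) :
    ∃ ξ : A.ProlongationSection, ∀ (Z : A.ProlongationSection) (a : DualBundle F E),
      a.proj ∈ frameDomain EM F E x₀ → symplecticSection ξ Z a =
        mvfderiv (𝓘(ℝ, EM).prod 𝓘(ℝ, F →L[ℝ] ℝ)) H a (Z.anchorField a) := by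
  -- The coefficients of the solution are derivatives of `H` along the global sections `S u ψ`,
  -- which makes them smooth on the whole of `E*`.
  let b := Module.finBasis ℝ F
  let l : Fin (Module.finrank ℝ F) → F →L[ℝ] ℝ := fun i =>
    LinearMap.toContinuousLinearMap (b.coord i)
  let S : F → (F →L[ℝ] ℝ) → A.ProlongationSection := fun u ψ =>
    A.localSection x₀ (contMDiff_const (c := u)) (contMDiff_const (c := ψ))
  let dH : A.ProlongationSection → DualBundle F E → ℝ := fun Z a =>
    mvfderiv (𝓘(ℝ, EM).prod 𝓘(ℝ, F →L[ℝ] ℝ)) H a (Z.anchorField a)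
  have hdH : ∀ Z, ContMDiff (𝓘(ℝ, EM).prod 𝓘(ℝ, F →L[ℝ] ℝ)) 𝓘(ℝ, ℝ) ∞ (dH Z) :=
    A.contMDiff_mvfderiv_anchorField hH
  let br : Fin (Module.finrank ℝ F) → Fin (Module.finrank ℝ F) → DualBundle F E → ℝ :=
    fun j i a => a.2 (A.bracket (frameSection EM E x₀ (b j)) (frameSection EM E x₀ (b i)) a.proj)
  have hbr : ∀ j i, ContMDiff (𝓘(ℝ, EM).prod 𝓘(ℝ, F →L[ℝ] ℝ)) 𝓘(ℝ, ℝ) ∞ (br j i) :=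
    fun j i => contMDiff_pairing _
  let y : DualBundle F E → F := fun a => ∑ i, dH (S 0 (l i)) a • b i
  let φ : DualBundle F E → F →L[ℝ] ℝ := fun a =>
    ∑ i, (∑ j, dH (S 0 (l j)) a * br j i a - dH (S (b i) 0) a) • l i
  have hy : ContMDiff (𝓘(ℝ, EM).prod 𝓘(ℝ, F →L[ℝ] ℝ)) 𝓘(ℝ, F) ∞ y :=
    contMDiff_finsetSum fun i _ => (hdH _).smul contMDiff_const
  have hφ : ContMDiff (𝓘(ℝ, EM).prod 𝓘(ℝ, F →L[ℝ] ℝ)) 𝓘(ℝ, F →L[ℝ] ℝ) ∞ φ :=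
    contMDiff_finsetSum fun i _ =>
      ((contMDiff_finsetSum fun j _ => (hdH _).mul (hbr j i)).sub (hdH _)).smul contMDiff_const
  refine ⟨A.localSection x₀ hy hφ, fun Z a ha => ?_⟩
  set D : F × (F →L[ℝ] ℝ) →L[ℝ] ℝ := (mvfderiv (𝓘(ℝ, EM).prod 𝓘(ℝ, F →L[ℝ] ℝ)) H a).comp
    (A.liftVector x₀ a)
  have hSD : ∀ u ψ, dH (S u ψ) a = D (u, ψ) := fun u ψ => by
    simp only [dH, S, A.anchorField_localSection _ _ ha]
    rfl
  set z := Z.coord x₀ a with hz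
  set ψ := mvfderiv (𝓘(ℝ, EM).prod 𝓘(ℝ, F →L[ℝ] ℝ)) (fiberCoord F x₀) a (Z.anchorField a) with hψ
  have hZ : mvfderiv (𝓘(ℝ, EM).prod 𝓘(ℝ, F →L[ℝ] ℝ)) H a (Z.anchorField a) = D (z, ψ) := by
    rw [Z.anchorField_eq_liftVector (frameDomain_subset_coordDomain x₀ ha)]
    rfl
  have hsumψ : ψ = ∑ i, ψ (b i) • l i := by
    refine ContinuousLinearMap.coe_injective (b.ext fun k => ?_)
    simp [l, Finsupp.single_apply]
  have hψy : ψ (y a) = D (0, ψ) := by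
    have h1 : D (0, ψ) = (D.comp (ContinuousLinearMap.inr ℝ F (F →L[ℝ] ℝ))) ψ := rfl
    rw [h1]
    conv_rhs => rw [hsumψ]
    simp [y, hSD, mul_comm]
  have hφz : φ a z = A.frameBracket x₀ a (y a) z - D (z, 0) := by
    have h1 : (φ a : F →ₗ[ℝ] ℝ) = A.frameBracket x₀ a (y a)
        - (D.comp (ContinuousLinearMap.inl ℝ F (F →L[ℝ] ℝ)) : F →ₗ[ℝ] ℝ) := by
      refine b.ext fun k => ?_
      simp [φ, y, l, br, hSD, Finsupp.single_apply, ← frameBracket_apply]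
    exact DFunLike.congr_fun h1 z
  rw [symplecticSection_eq _ _ ha, A.coord_localSection _ _ ha,
    A.mvfderiv_fiberCoord_localSection _ _ ha, hZ, ← hz, ← hψ, ← frameBracket_apply, hψy, hφz,
    show (z, ψ) = (z, (0 : F →L[ℝ] ℝ)) + (0, ψ) by simp, map_add]
  ring

/-- The Hamiltonian section exists and is unique. Its value at `a` is that of the local solution
attached to the point `τ*(a)`; as all local solutions agree where they are defined, this coincides
near `a₀` with the single smooth section attached to `τ*(a₀)`. -/
theorem existsUnique_hamiltonianSection {H : DualBundle F E → ℝ}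
    (hH : ContMDiff (𝓘(ℝ, EM).prod 𝓘(ℝ, F →L[ℝ] ℝ)) 𝓘(ℝ, ℝ) ∞ H) :
    ∃! ξ : A.ProlongationSection, IsHamiltonianSection H ξ := by
  choose η hη using A.exists_local_hamiltonianSection hH
  have heq : ∀ a₀ : DualBundle F E, ∀ᶠ a in 𝓝 a₀, (η a.proj).val a = (η a₀.proj).val a := by
    intro a₀
    filter_upwards [eventually_proj_mem (isOpen_frameDomain (EM := EM) (F := F) (E := E) a₀.proj)
      (mem_frameDomain_self a₀.proj)] with a ha
    refine val_eq_of_symplecticSection_eq fun Z => ?_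
    rw [hη _ Z a (mem_frameDomain_self a.proj), hη _ Z a ha]
  let ξ : A.ProlongationSection :=
    { val := fun a => (η a.proj).val a
      smooth_fst := fun a₀ => ((η a₀.proj).smooth_fst a₀).congr_of_eventuallyEq
        ((heq a₀).mono fun a ha => by simp only [ha])
      smooth_snd := fun a₀ => ((η a₀.proj).smooth_snd a₀).congr_of_eventuallyEq
        ((heq a₀).mono fun a ha => by simp only [ha]) }
  refine ⟨ξ, fun Z a => ?_, fun ξ' hξ' => ?_⟩
  · rw [← hη a.proj Z a (mem_frameDomain_self a.proj),
      symplecticSection_eq _ _ (mem_frameDomain_self a.proj),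
      symplecticSection_eq _ _ (mem_frameDomain_self a.proj)]
    rfl
  · refine ProlongationSection.ext (funext fun a => val_eq_of_symplecticSection_eq fun Z => ?_)
    rw [hξ' Z a, ← hη a.proj Z a (mem_frameDomain_self a.proj),
      symplecticSection_eq _ _ (mem_frameDomain_self a.proj),
      symplecticSection_eq _ _ (mem_frameDomain_self a.proj)]
    rfl

end LieAlgebroid

namespace LieAlgebroid

variable {EM : Type*} [NormedAddCommGroup EM] [NormedSpace ℝ EM] [FiniteDimensional ℝ EM]
  {M : Type*} [TopologicalSpace M] [ChartedSpace EM M] [IsManifold 𝓘(ℝ, EM) ∞ M] [T2Space M]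
  {F : Type*} [NormedAddCommGroup F] [NormedSpace ℝ F] [FiniteDimensional ℝ F]
  {E : M → Type*} [∀ x, AddCommGroup (E x)] [∀ x, Module ℝ (E x)]
  [∀ x, TopologicalSpace (E x)] [TopologicalSpace (TotalSpace F E)]
  [FiberBundle F E] [VectorBundle ℝ F E] [ContMDiffVectorBundle ∞ F E 𝓘(ℝ, EM)]

/-! ### The Hamilton–Jacobi equation -/

theorem contMDiff_sectionMap (α : DualSections (EM := EM) F E) :
    ContMDiff 𝓘(ℝ, EM) (𝓘(ℝ, EM).prod 𝓘(ℝ, F →L[ℝ] ℝ)) ∞ (sectionMap α) := α.contMDiff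

theorem mdifferentiableAt_sectionMap (α : DualSections (EM := EM) F E) (x : M) :
    MDifferentiableAt 𝓘(ℝ, EM) (𝓘(ℝ, EM).prod 𝓘(ℝ, F →L[ℝ] ℝ)) (sectionMap α) x :=
  (contMDiff_sectionMap α x).mdifferentiableAt (by simp)

theorem projDeriv_mfderiv_sectionMap (α : DualSections (EM := EM) F E) (x : M)
    (v : TangentSpace 𝓘(ℝ, EM) x) :
    projDeriv (sectionMap α x)
      (mfderiv 𝓘(ℝ, EM) (𝓘(ℝ, EM).prod 𝓘(ℝ, F →L[ℝ] ℝ)) (sectionMap α) x v) = v := by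
  have h := mfderiv_comp_apply x (mdifferentiableAt_proj (EM := EM) (sectionMap α x))
    (mdifferentiableAt_sectionMap α x) v
  have h2 : (fun a' : DualBundle F E => a'.proj) ∘ sectionMap α = id := rfl
  rw [h2, mfderiv_id] at h
  exact h.symm

variable {A : LieAlgebroid (EM := EM) F E}

/-- For a cocycle `α`, the differential of `H ∘ α` measures, in fibre coordinates, the failure of
the Hamiltonian vector field to be the image under `Tα` of its projection. -/
theorem dFun_comp_sectionMap_apply {H : DualBundle F E → ℝ}
    (hH : ContMDiff (𝓘(ℝ, EM).prod 𝓘(ℝ, F →L[ℝ] ℝ)) 𝓘(ℝ, ℝ) ∞ H)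
    {α : DualSections (EM := EM) F E} (hα : A.IsCocycle α) {ξ : A.ProlongationSection}
    (hξ : IsHamiltonianSection H ξ) (x : M) (u : F) :
    A.dFun (fun x => H (sectionMap α x)) x ((trivializationAt F E x).symmL ℝ x u) =
      mvfderiv (𝓘(ℝ, EM).prod 𝓘(ℝ, F →L[ℝ] ℝ)) (fiberCoord F x) (sectionMap α x)
          (mfderiv 𝓘(ℝ, EM) (𝓘(ℝ, EM).prod 𝓘(ℝ, F →L[ℝ] ℝ)) (sectionMap α) x
            (A.anchor x (ξ.fst (sectionMap α x)))) u
        - mvfderiv (𝓘(ℝ, EM).prod 𝓘(ℝ, F →L[ℝ] ℝ)) (fiberCoord F x) (sectionMap α x)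
          (ξ.anchorField (sectionMap α x)) u := by
  set a := sectionMap α x
  have hx : a.proj ∈ frameDomain EM F E x := mem_frameDomain_self x
  have hx' : x ∈ frameDomain EM F E x := mem_frameDomain_self x
  have hc := frameDomain_subset_coordDomain x hx
  have hP : MDifferentiableAt (𝓘(ℝ, EM).prod 𝓘(ℝ, F →L[ℝ] ℝ)) 𝓘(ℝ, F →L[ℝ] ℝ)
      (fiberCoord F x : DualBundle F E → _) a :=
    (contMDiffAt_fiberCoord hc.1).mdifferentiableAt (by simp)
  have hmα := mdifferentiableAt_sectionMap α x
  set Tα := mfderiv 𝓘(ℝ, EM) (𝓘(ℝ, EM).prod 𝓘(ℝ, F →L[ℝ] ℝ)) (sectionMap α) x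
  set ψ := mvfderiv (𝓘(ℝ, EM).prod 𝓘(ℝ, F →L[ℝ] ℝ)) (fiberCoord F x) a
    (Tα (A.anchor x ((trivializationAt F E x).symmL ℝ x u))) with hψ
  -- The test vector is the tangent lift of `ρ(e_u)` by `α`, so that `dH` on it is
  -- `d(H ∘ α)(ρ(e_u))`.
  have hlift : A.liftVector x a (u, ψ) =
      Tα (A.anchor x ((trivializationAt F E x).symmL ℝ x u)) := by
    refine tangent_ext hc ?_ ?_
    · rw [A.projDeriv_liftVector hc]
      exact (projDeriv_mfderiv_sectionMap α x _).symm
    · rw [A.mvfderiv_fiberCoord_liftVector hc]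
  have h1 := hξ (A.localSection x (contMDiff_const (c := u)) (contMDiff_const (c := ψ))) a
  rw [symplecticSection_localSection_const _ hx, A.anchorField_localSection _ _ hx, hlift] at h1
  have hpair : ∀ (w : F) (v : TangentSpace 𝓘(ℝ, EM) x),
      mvfderiv 𝓘(ℝ, EM) (fun y => α y (frameSection EM E x w y)) x v
        = mvfderiv (𝓘(ℝ, EM).prod 𝓘(ℝ, F →L[ℝ] ℝ)) (fiberCoord F x) a (Tα v) w := fun w v => by
    have hev : (fun y => α y (frameSection EM E x w y)) =ᶠ[𝓝 x]
        fun y => fiberCoord F x (sectionMap α y) w := by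
      filter_upwards [(isOpen_frameDomain x).mem_nhds hx] with y hy
      rw [frameSection_apply_of_mem hy]
      rfl
    rw [mvfderiv_congr hev, mvfderiv_apply_const (g := fun y => fiberCoord F x (sectionMap α y))
      (hP.comp x hmα)]
    exact DFunLike.congr_fun (mvfderiv_comp_vector (f := sectionMap α) hP hmα v) w
  have hfst : frameSection EM E x (ξ.coord x a) x = ξ.fst a := by
    rw [frameSection_apply_of_mem hx']
    exact ξ.symmL_coord hc.1
  -- The cocycle condition on the sections with constant coordinates through `σ(x)` and `e_u`.
  have h2 := hα (frameSection EM E x (ξ.coord x a)) (frameSection EM E x u) x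
  rw [dForm, hpair, hpair, hfst, frameSection_apply_of_mem hx', ← hψ] at h2
  have h3 : A.dFun (fun x => H (sectionMap α x)) x ((trivializationAt F E x).symmL ℝ x u)
      = mvfderiv (𝓘(ℝ, EM).prod 𝓘(ℝ, F →L[ℝ] ℝ)) H a
        (Tα (A.anchor x ((trivializationAt F E x).symmL ℝ x u))) :=
    mvfderiv_comp_vector (f := sectionMap α) (g := H) ((hH a).mdifferentiableAt (by simp)) hmα _
  have h4 : A.frameBracket x a (ξ.coord x a) u
      = α x (A.bracket (frameSection EM E x (ξ.coord x a)) (frameSection EM E x u) x) := rfl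
  rw [h3, ← h1, h4]
  linarith

/-- The Hamilton–Jacobi equation at a point `x` says that the Hamiltonian vector field is
`α`-related, at `x`, to its projection. -/
theorem dFun_comp_sectionMap_eq_zero_iff {H : DualBundle F E → ℝ}
    (hH : ContMDiff (𝓘(ℝ, EM).prod 𝓘(ℝ, F →L[ℝ] ℝ)) 𝓘(ℝ, ℝ) ∞ H)
    {α : DualSections (EM := EM) F E} (hα : A.IsCocycle α) {ξ : A.ProlongationSection}
    (hξ : IsHamiltonianSection H ξ) (x : M) :
    A.dFun (fun x => H (sectionMap α x)) x = 0 ↔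
      mfderiv 𝓘(ℝ, EM) (𝓘(ℝ, EM).prod 𝓘(ℝ, F →L[ℝ] ℝ)) (sectionMap α) x
        (A.anchor x (ξ.fst (sectionMap α x))) = ξ.anchorField (sectionMap α x) := by
  have key := dFun_comp_sectionMap_apply hH hα hξ x
  constructor
  · intro h
    refine tangent_ext (x₀ := x) (frameDomain_subset_coordDomain x (mem_frameDomain_self x)) ?_ ?_
    · rw [ξ.projDeriv_anchorField]
      exact projDeriv_mfderiv_sectionMap α x _
    · ext u
      have := key u
      rw [h] at this
      exact sub_eq_zero.1 this.symm
  · intro h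
    ext v
    have := key ((trivializationAt F E x).continuousLinearMapAt ℝ x v)
    rw [h, sub_self, Trivialization.symmL_continuousLinearMapAt _
      (FiberBundle.mem_baseSet_trivializationAt' x)] at this
    exact this

variable (A)

/-- Through every point passes an integral curve, on an open interval, of the vector field `ρ(X)` of
a section `X` of `E`. -/
theorem exists_integralCurve (X : SmoothSections (EM := EM) F E) (x : M) :
    ∃ (c : ℝ → M) (J : Set ℝ), IsOpen J ∧ J.OrdConnected ∧ (0 : ℝ) ∈ J ∧ c 0 = x ∧
      IsMIntegralCurveOn c (A.anchorField X) J := by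
  have : CompleteSpace EM := FiniteDimensional.complete ℝ EM
  have hsm : ContMDiff 𝓘(ℝ, EM) 𝓘(ℝ, EM).tangent ∞
      (fun x => (⟨x, A.anchorField X x⟩ : TangentBundle 𝓘(ℝ, EM) M)) :=
    A.anchor.contMDiff.clm_bundle_apply X.contMDiff
  obtain ⟨c, hc0, hc⟩ := exists_isMIntegralCurveAt_of_contMDiffAt_boundaryless (t₀ := 0)
    ((hsm x).of_le (by simp))
  obtain ⟨ε, hε, h⟩ := isMIntegralCurveAt_iff'.1 hc
  refine ⟨c, Metric.ball 0 ε, Metric.isOpen_ball, ?_, Metric.mem_ball_self hε, hc0, h⟩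
  rw [Real.ball_eq_Ioo]
  exact ordConnected_Ioo

variable {A}

/-- The derivative of a function along an integral curve of `ρ(s)` is `d^E f` evaluated on `s`. -/
theorem hasDerivAt_comp_integralCurve {f : M → ℝ}
    (hf : MDifferentiable 𝓘(ℝ, EM) 𝓘(ℝ, ℝ) f) {s : ∀ x, E x} {c : ℝ → M} {J : Set ℝ}
    (hJ : IsOpen J) (hc : IsMIntegralCurveOn c (A.anchorField s) J) {t : ℝ} (ht : t ∈ J) :
    HasDerivAt (fun τ => f (c τ)) (A.dFun f (c t) (s (c t))) t := by
  have h := (hf (c t)).hasMFDerivAt.comp t ((hc t ht).hasMFDerivAt (hJ.mem_nhds ht))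
  have h2 : HasFDerivAt (fun τ => f (c τ))
      ((1 : ℝ →L[ℝ] ℝ).smulRight (A.dFun f (c t) (s (c t)))) t :=
    (h.congr_mfderiv (comp_smulRight_one (V := EM) (W := ℝ) _ _)).hasFDerivAt
  simpa using h2.hasDerivAt

theorem eq_of_flowStep {f : M → ℝ} (hf : MDifferentiable 𝓘(ℝ, EM) 𝓘(ℝ, ℝ) f)
    (h : A.dFun f = 0) {x y : M} (hxy : A.FlowStep x y) : f y = f x := by
  obtain ⟨X, c, J, hJ, hJc, hc, s, hs, t, ht, rfl, rfl⟩ := hxy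
  have hd : ∀ τ ∈ J, HasDerivAt (fun τ => f (c τ)) 0 τ := fun τ hτ => by
    have := hasDerivAt_comp_integralCurve hf hJ hc hτ
    rwa [h] at this
  exact hJ.is_const_of_deriv_eq_zero hJc.isPreconnected
    (fun τ hτ => (hd τ hτ).differentiableAt.differentiableWithinAt)
    (fun τ hτ => (hd τ hτ).deriv) ht hs

/-- One direction integrates `d^E f` along flow steps. In the other, an integral curve through `x`
of `ρ(X)`, where `X(x)` is a given vector, stays in the leaf of `x`, so `f` is constant along it. -/
theorem dFun_eq_zero_iff_leaf {f : M → ℝ} (hf : MDifferentiable 𝓘(ℝ, EM) 𝓘(ℝ, ℝ) f) :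
    A.dFun f = 0 ↔ ∀ x, ∀ y ∈ A.leaf x, f y = f x := by
  constructor
  · intro h x y hy
    induction hy with
    | refl => rfl
    | tail _ hstep ih => rw [eq_of_flowStep hf h hstep, ih]
  · intro h
    funext x
    ext v
    let X : SmoothSections (EM := EM) F E :=
      frameSection EM E x ((trivializationAt F E x).continuousLinearMapAt ℝ x v)
    have hX : X x = v := by
      simp only [X]
      rw [frameSection_apply_of_mem (mem_frameDomain_self x),
        Trivialization.symmL_continuousLinearMapAt _ (FiberBundle.mem_baseSet_trivializationAt' x)]
    obtain ⟨c, J, hJ, hJc, h0, hc0, hc⟩ := A.exists_integralCurve X x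
    have hd := hasDerivAt_comp_integralCurve hf hJ hc h0
    have hconst : (fun τ => f (c τ)) =ᶠ[𝓝 0] fun _ => f x := by
      filter_upwards [hJ.mem_nhds h0] with τ hτ
      exact h x (c τ) (Relation.ReflTransGen.single ⟨X, c, J, hJ, hJc, hc, 0, h0, τ, hτ, hc0, rfl⟩)
    have := hd.unique ((hasDerivAt_const (0 : ℝ) (f x)).congr_of_eventuallyEq hconst)
    rw [hc0, hX] at this
    exact this

/-- The Hamilton–Jacobi theorem: the integral curves of `ρ(σ)` lift under `α` to solutions of the
Hamilton equations if and only if `d^E (H ∘ α) = 0`. -/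
theorem solvesHamiltonEquations_iff {H : DualBundle F E → ℝ}
    (hH : ContMDiff (𝓘(ℝ, EM).prod 𝓘(ℝ, F →L[ℝ] ℝ)) 𝓘(ℝ, ℝ) ∞ H)
    {α : DualSections (EM := EM) F E} (hα : A.IsCocycle α) {ξ : A.ProlongationSection}
    (hξ : IsHamiltonianSection H ξ) :
    (∀ (c : ℝ → M) (J : Set ℝ), IsOpen J → J.OrdConnected →
      IsMIntegralCurveOn c (A.anchorField fun x => ξ.fst (sectionMap α x)) J →
      SolvesHamiltonEquations ξ (fun t => sectionMap α (c t)) J) ↔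
    A.dFun (fun x => H (sectionMap α x)) = 0 := by
  have hcomp : ∀ (c : ℝ → M) (J : Set ℝ),
      IsMIntegralCurveOn c (A.anchorField fun x => ξ.fst (sectionMap α x)) J → ∀ t ∈ J,
      HasMFDerivWithinAt 𝓘(ℝ, ℝ) (𝓘(ℝ, EM).prod 𝓘(ℝ, F →L[ℝ] ℝ))
        (fun t => sectionMap α (c t)) J t ((1 : ℝ →L[ℝ] ℝ).smulRight
          (mfderiv 𝓘(ℝ, EM) (𝓘(ℝ, EM).prod 𝓘(ℝ, F →L[ℝ] ℝ)) (sectionMap α) (c t)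
            (A.anchor (c t) (ξ.fst (sectionMap α (c t)))))) := fun c J hc t ht => by
    have h := (mdifferentiableAt_sectionMap α (c t)).hasMFDerivAt.comp_hasMFDerivWithinAt t
      (hc t ht)
    exact h.congr_mfderiv (comp_smulRight_one (V := EM) (W := EM × (F →L[ℝ] ℝ)) _ _)
  constructor
  · intro h
    funext x
    rw [Pi.zero_apply, dFun_comp_sectionMap_eq_zero_iff hH hα hξ]
    let σ : SmoothSections (EM := EM) F E :=
      ⟨fun x => ξ.fst (sectionMap α x), ξ.smooth_fst.comp (contMDiff_sectionMap α)⟩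
    obtain ⟨c, J, hJ, hJc, h0, rfl, hc⟩ := A.exists_integralCurve σ x
    have h1 := (hcomp c J hc 0 h0).hasMFDerivAt (hJ.mem_nhds h0)
    have h2 := (h c J hJ hJc hc 0 h0).hasMFDerivAt (hJ.mem_nhds h0)
    have h3 := hasMFDerivAt_unique h1 h2
    exact smulRight_one_injective (V := EM × (F →L[ℝ] ℝ)) h3
  · intro h c J hJ hJc hc t ht
    have := (dFun_comp_sectionMap_eq_zero_iff hH hα hξ (c t)).1 (by rw [h]; rfl)
    rw [← this]
    exact hcomp c J hc t ht

end LieAlgebroid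

end

theorem theorem3p10
    {EM : Type*} [NormedAddCommGroup EM] [NormedSpace ℝ EM] [FiniteDimensional ℝ EM]
    {M : Type*} [TopologicalSpace M] [ChartedSpace EM M] [IsManifold 𝓘(ℝ, EM) ∞ M]
    [T2Space M] [ParacompactSpace M]
    {F : Type*} [NormedAddCommGroup F] [NormedSpace ℝ F] [FiniteDimensional ℝ F]
    {E : M → Type*} [∀ x, AddCommGroup (E x)] [∀ x, Module ℝ (E x)]
    [∀ x, TopologicalSpace (E x)] [TopologicalSpace (TotalSpace F E)]
    [FiberBundle F E] [VectorBundle ℝ F E] [ContMDiffVectorBundle ∞ F E 𝓘(ℝ, EM)]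
    (A : LieAlgebroid (EM := EM) F E)
    (H : DualBundle F E → ℝ)
    (hH : ContMDiff (𝓘(ℝ, EM).prod 𝓘(ℝ, F →L[ℝ] ℝ)) 𝓘(ℝ, ℝ) ∞ H)
    (α : DualSections (EM := EM) F E) (hα : A.IsCocycle α) :
    (∃! ξ : A.ProlongationSection, LieAlgebroid.IsHamiltonianSection H ξ) ∧
    ∀ ξ : A.ProlongationSection, LieAlgebroid.IsHamiltonianSection H ξ →
      ((∀ (c : ℝ → M) (J : Set ℝ), IsOpen J → J.OrdConnected →
          IsMIntegralCurveOn c (A.anchorField fun x => ξ.fst (sectionMap α x)) J →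
          LieAlgebroid.SolvesHamiltonEquations ξ (fun t => sectionMap α (c t)) J) ↔
        A.dFun (fun x => H (sectionMap α x)) = 0) ∧
      (A.dFun (fun x => H (sectionMap α x)) = 0 ↔
        ∀ x, ∀ y ∈ A.leaf x, H (sectionMap α y) = H (sectionMap α x)) :=
  ⟨A.existsUnique_hamiltonianSection hH, fun _ hξ =>
    ⟨LieAlgebroid.solvesHamiltonEquations_iff hH hα hξ,
      LieAlgebroid.dFun_eq_zero_iff_leaf
        ((hH.comp (LieAlgebroid.contMDiff_sectionMap α)).mdifferentiable (by simp))⟩⟩
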